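/- Let $0<k<1$, let $\mathrm{sn},\mathrm{cn},\mathrm{dn}$ be the Jacobi elliptic functions of modulus $k$, let $K=K(k)$ be the complete elliptic integral of the first kind, $K'=K(\sqrt{1-k^2})$ and $q=\exp(-\pi K'/K)$. Let $w$ be a real number with $w\neq 2KM/N$ for all integers $M$ and $N\ne 0$. Put $c_n=\mathrm{dn}(wn)$ for $n\in\mathbb Z$, let $\mathcal L$ be the linear functional on Laurent polynomials with $\mathcal L\{z^n\}=c_n$, let $\Delta_n=\det(c_{j-i})_{0\le i,j<n}$ and $h_n=\Delta_{n+1}/\Delta_n$, and let $$\Phi_n(z)=\Phi^{(D)}_n(z)=\frac1{\Delta_n}\begin{vmatrix}c_0&c_1&\cdots&c_n\\ c_{-1}&c_0&\cdots&c_{n-1}\\ \vdots&\vdots&&\vdots\\ c_{1-n}&c_{2-n}&\cdots&c_1\\ 1&z&\cdots&z^n\end{vmatrix}$$ be the monic polynomials with moments $c_n$. Then: (1) All $\Delta_n$ are positive, $\Phi_n$ is monic of degree $n$, and $\mathcal L\{\Phi_n(z)\Phi_m(1/z)\}=h_n\delta_{nm}$ for all $n,m\ge 0$. (2) The reflection parameters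 $a_n=-\Phi_{n+1}(0)$ are $$a_{2n}=\mathrm{dn}(w(2n+1)),\qquad a_{2n+1}=-\mathrm{cn}(w(2n+2)),\qquad n\ge 0;$$ they satisfy $-1<a_n<1$, and $\Phi_0=1$, $\Phi_{n+1}(z)=z\Phi_n(z)-a_nz^n\Phi_n(1/z)$. (3) With the elliptic binomial coefficients $E^n_s=\prod_{j=0}^{s-1}\frac{\mathrm{sn}(w(n-j))}{\mathrm{sn}(w(j+1))}$ for $0\le s\le n$, one has $\Phi_n(z)=\sum_{s=0}^nW_{ns}z^s$, where $$W_{ns}=(-1)^s\,\mathrm{cn}(w(n-s))\,E^n_s\ \ (n\text{ even}),\qquad W_{ns}=(-1)^{s+1}\,\mathrm{dn}(w(n-s))\,E^n_s\ \ (n\text{ odd}).$$ (4) Let $z_s=\exp(i\pi ws/K)$ and $\rho_s=\frac{\pi}{K}\,\frac{1}{q^s+q^{-s}}$ for $s\in\mathbb Z$. The weights $\rho_s$ are positive, the points $z_s$ are pairwise distinct and dense in the unit circle, $\sum_{s=-\infty}^{\infty}\rho_sz_s^n=\mathrm{dn}(wn)$ for all $n\in\mathbb Z$, and for all $n,m\ge0$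 $$\sum_{s=-\infty}^{\infty}\rho_s\,\Phi_n(z_s)\,\Phi_m(1/z_s)=h_n\delta_{nm},\qquad h_n=\prod_{i=0}^{n-1}(1-a_i^2)>0,$$ all the series converging absolutely. -/

import Mathlib

open Polynomial

noncomputable section

/-- Incomplete elliptic integral of the first kind, as a function of the modulus `k`
and the amplitude `φ`. -/
def ellipticF (k φ : ℝ) : ℝ :=
  ∫ θ in (0 : ℝ)..φ, 1 / Real.sqrt (1 - k ^ 2 * Real.sin θ ^ 2)

/-- Complete elliptic integral of the first kind `K(k)`. -/
def ellipticK (k : ℝ) : ℝ := ellipticF k (Real.pi / 2)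

/-- The Jacobi amplitude `am(u; k)`: the inverse function of `φ ↦ F(φ; k)`. -/
def jacobiAm (k u : ℝ) : ℝ := Function.invFun (ellipticF k) u

/-- The Jacobi elliptic functions of a real argument. -/
def jacobiSn (k u : ℝ) : ℝ := Real.sin (jacobiAm k u)

def jacobiCn (k u : ℝ) : ℝ := Real.cos (jacobiAm k u)

def jacobiDn (k u : ℝ) : ℝ := Real.sqrt (1 - k ^ 2 * jacobiSn k u ^ 2)

/-- The complementary integral `K' = K(k')`, `k'^2 = 1 - k^2`. -/
def ellipticK' (k : ℝ) : ℝ := ellipticK (Real.sqrt (1 - k ^ 2))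

/-- The nome `q = exp(-π K' / K)`. -/
def ellipticNome (k : ℝ) : ℝ := Real.exp (-Real.pi * ellipticK' k / ellipticK k)

/-- For `0 < k < 1` the map `φ ↦ F(φ; k)` is a bijection of the real line, so `jacobiAm k` is its
two-sided inverse. -/
theorem ellipticF_bijective {k : ℝ} (hk0 : 0 < k) (hk1 : k < 1) :
    Function.Bijective (ellipticF k) := by
  have hk2 : k ^ 2 < 1 := by nlinarith
  have hpos : ∀ θ : ℝ, 0 < 1 - k ^ 2 * Real.sin θ ^ 2 := fun θ => by
    nlinarith [Real.sin_sq_le_one θ, sq_nonneg k, sq_nonneg (Real.sin θ)]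
  have hcont : Continuous fun θ : ℝ => 1 / Real.sqrt (1 - k ^ 2 * Real.sin θ ^ 2) := by
    refine continuous_const.div (by fun_prop) fun θ => ?_
    exact (Real.sqrt_pos.2 (hpos θ)).ne'
  have hge : ∀ θ : ℝ, 1 ≤ 1 / Real.sqrt (1 - k ^ 2 * Real.sin θ ^ 2) := fun θ => by
    rw [le_div_iff₀ (Real.sqrt_pos.2 (hpos θ)), one_mul]
    exact Real.sqrt_le_one.2 (by nlinarith [mul_nonneg (sq_nonneg k) (sq_nonneg (Real.sin θ))])
  have hinc : ∀ a b : ℝ, a ≤ b → b - a ≤ ellipticF k b - ellipticF k a := fun a b hab => by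
    have h1 : ellipticF k b - ellipticF k a =
        ∫ θ in a..b, 1 / Real.sqrt (1 - k ^ 2 * Real.sin θ ^ 2) :=
      intervalIntegral.integral_interval_sub_left (hcont.intervalIntegrable _ _)
        (hcont.intervalIntegrable _ _)
    have h2 : ∫ _ in a..b, (1 : ℝ) = b - a := by simp
    rw [h1, ← h2]
    exact intervalIntegral.integral_mono_on hab (by simp) (hcont.intervalIntegrable _ _)
      fun θ _ => hge θ
  have hF : Continuous (ellipticF k) :=
    intervalIntegral.continuous_primitive (fun a b => hcont.intervalIntegrable a b) 0
  have h0 : ellipticF k 0 = 0 := by simp [ellipticF]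
  refine ⟨fun a b hab => ?_, fun u => ?_⟩
  · rcases le_total a b with h | h
    · linarith [hinc a b h]
    · linarith [hinc b a h]
  · have hlo : ellipticF k (-|u|) ≤ u := by
      linarith [hinc (-|u|) 0 (by simp), neg_abs_le u]
    have hhi : u ≤ ellipticF k |u| := by
      linarith [hinc 0 |u| (abs_nonneg u), le_abs_self u]
    obtain ⟨φ, -, hφ⟩ := intermediate_value_Icc
      (by linarith [abs_nonneg u] : -|u| ≤ |u|) hF.continuousOn ⟨hlo, hhi⟩
    exact ⟨φ, hφ⟩

/-- The elliptic binomial coefficients `E_j^n`. -/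
def ellipticBinom (k w : ℝ) (n j : ℕ) : ℝ :=
  if j ≤ n then
    ∏ s ∈ Finset.range j, jacobiSn k (w * ((n : ℝ) - s)) / jacobiSn k (w * ((s : ℝ) + 1))
  else 0

/-- The Toeplitz determinant `Δ_n = det (c_{j-i})_{0 ≤ i, j < n}` of a moment sequence. -/
def toeplitzDet (c : ℤ → ℝ) (n : ℕ) : ℝ :=
  Matrix.det (Matrix.of fun i j : Fin n => c ((j : ℤ) - (i : ℤ)))

/-- The monic polynomial of degree `n` attached to the moments `c`: `Δ_n⁻¹` times the determinant
whose rows are `(c_{-i}, …, c_{n-i})` for `i < n`, followed by the last row `(1, z, …, z^n)`. -/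
def circlePoly (c : ℤ → ℝ) (n : ℕ) : ℝ[X] :=
  C (toeplitzDet c n)⁻¹ *
    Matrix.det (Matrix.of fun i j : Fin (n + 1) =>
      if (i : ℕ) < n then C (c ((j : ℤ) - (i : ℤ))) else (X : ℝ[X]) ^ (j : ℕ))

/-- The normalization constants `h_n = Δ_{n+1} / Δ_n`. -/
def circleNorm (c : ℤ → ℝ) (n : ℕ) : ℝ := toeplitzDet c (n + 1) / toeplitzDet c n

/-- The reflection parameters `a_n = -Φ_{n+1}(0)` of a sequence of polynomials (real case). -/
def reflectionParam (Φ : ℕ → ℝ[X]) (n : ℕ) : ℝ := -(Φ (n + 1)).eval 0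

/-- The linear functional on Laurent polynomials with `z^n ↦ c n`. -/
def momentFunctional (c : ℤ → ℝ) : LaurentPolynomial ℝ →ₗ[ℝ] ℝ :=
  Finsupp.linearCombination ℝ c ∘ₗ (AddMonoidAlgebra.coeffLinearEquiv ℝ).toLinearMap

/-- The moments `c_n = dn(w n; k)`. -/
def dnMoment (k w : ℝ) (n : ℤ) : ℝ := jacobiDn k (w * n)

/-- The polynomials `Φ_n^{(D)}`, that is, the ones attached to the moments `dn(w n; k)`. -/
def dnPoly (k w : ℝ) (n : ℕ) : ℝ[X] := circlePoly (dnMoment k w) n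

/-- The spectral points `z_s = exp(i π w s / K)`. -/
def dnPoint (k w : ℝ) (s : ℤ) : ℂ :=
  Complex.exp (Complex.I * Real.pi * w * s / ellipticK k)

/-- The weights `ρ_s = (π / K) / (q^s + q^{-s})`. -/
def dnWeight (k : ℝ) (s : ℤ) : ℝ :=
  Real.pi / ellipticK k * (1 / (ellipticNome k ^ s + ellipticNome k ^ (-s)))

end

/-! The determinants are never computed directly. One starts from the answer: let `P_n` be the monic
polynomials produced by the Szegő recurrence with the expected parameters `a_n` (`szegoPoly` with
`dnReflection`). Because the moments are even in `n`, the numbers `M_n(j) = L{P_n z^{-j}}` satisfy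
`M_{n+1}(j) = M_n(j-1) - a_n M_n(n-j)`. The two subtraction identities `jacobiDn_sub_sub` and
`jacobiCn_sub_sub` make this recurrence solvable by a product: `M_n(j)` is a constant times `∏_{i<n}
sn(w(j-i))` times `dn` or `cn` of `w(j-n)` (`shiftedMoment_szegoPoly_dnReflection`). Since `sn 0 =
0`, it vanishes for `0 ≤ j < n`, which is orthogonality. The recurrence also gives `M_n(n) = ∏_{i<n}
(1 - a_i²)`, positive because the condition on `w` excludes the zeros of `sn`. Cramer's rule then
yields `Δ_{n+1} = M_n(n) Δ_n`, so all `Δ_n` are positive, and identifies `P_n` with the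
determinantal polynomial (`toeplitzDet_succ_eq`, `circlePoly_eq`). The coefficients follow by
induction along the same recurrence from a three-term form of the addition theorem.

The measure comes from the Fourier series of `dn`, evaluated at the points `wn`. Its coefficients
are found by moving the integral of `dn z · e^{-ilz}` over a period up to height `Y < K'`. Using
both `l` and `-l` gives `∫ Re dn(x+iY) cos(lx) dx = J cosh(lY)`, where `J` is the same integral at
height `0`. As `Y → K'` the pole at `iK'` turns `Re dn(x+iY)`, a nonnegative kernel of mass `π`,
into a point mass at `x = 0`; hence `J cosh(lK') = π` (`integral_jacobiDn_mul_cos`). The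
coefficients are summable, so the series converges to `dn` everywhere, and orthogonality for the
functional becomes orthogonality for the measure by linearity. -/

/-! ### Jacobi functions of a real argument: symmetry, quasi-periods, derivatives. -/

theorem one_sub_sq_mul_sin_sq_pos {k : ℝ} (hk0 : 0 < k) (hk1 : k < 1) (θ : ℝ) :
    0 < 1 - k ^ 2 * Real.sin θ ^ 2 := by
  have : k ^ 2 < 1 := by nlinarith
  nlinarith [Real.sin_sq_le_one θ, sq_nonneg k, sq_nonneg (Real.sin θ)]

theorem continuous_ellipticF_integrand {k : ℝ} (hk0 : 0 < k) (hk1 : k < 1) :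
    Continuous fun θ : ℝ => 1 / Real.sqrt (1 - k ^ 2 * Real.sin θ ^ 2) :=
  continuous_const.div (by fun_prop) fun θ =>
    (Real.sqrt_pos.2 (one_sub_sq_mul_sin_sq_pos hk0 hk1 θ)).ne'

theorem hasDerivAt_ellipticF {k : ℝ} (hk0 : 0 < k) (hk1 : k < 1) (φ : ℝ) :
    HasDerivAt (ellipticF k) (1 / Real.sqrt (1 - k ^ 2 * Real.sin φ ^ 2)) φ :=
  (continuous_ellipticF_integrand hk0 hk1).integral_hasStrictDerivAt 0 φ |>.hasDerivAt

theorem ellipticF_strictMono {k : ℝ} (hk0 : 0 < k) (hk1 : k < 1) : StrictMono (ellipticF k) :=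
  strictMono_of_hasDerivAt_pos (hasDerivAt_ellipticF hk0 hk1) fun φ =>
    one_div_pos.2 (Real.sqrt_pos.2 (one_sub_sq_mul_sin_sq_pos hk0 hk1 φ))

theorem ellipticF_zero (k : ℝ) : ellipticF k 0 = 0 := by simp [ellipticF]

theorem ellipticF_neg (k φ : ℝ) :
    ellipticF k (-φ) = -ellipticF k φ := by
  have h := intervalIntegral.integral_comp_neg (a := 0) (b := φ)
    (fun θ : ℝ => 1 / Real.sqrt (1 - k ^ 2 * Real.sin θ ^ 2))
  rw [ellipticF, ellipticF, intervalIntegral.integral_symm, neg_inj]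
  simpa using h.symm

theorem ellipticF_add_pi {k : ℝ} (hk0 : 0 < k) (hk1 : k < 1) (φ : ℝ) :
    ellipticF k (φ + Real.pi) = ellipticF k φ + 2 * ellipticK k := by
  -- The integrand has period `π`, so this difference is constant; oddness of `F` evaluates it at
  -- `-π/2`.
  have h : ∀ x y : ℝ, ellipticF k (x + Real.pi) - ellipticF k x =
      ellipticF k (y + Real.pi) - ellipticF k y := by
    refine is_const_of_deriv_eq_zero (f := fun x => ellipticF k (x + Real.pi) - ellipticF k x)
      (fun x => ?_) (fun x => ?_)
    · exact (((hasDerivAt_ellipticF hk0 hk1 _).comp_add_const x Real.pi).sub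
        (hasDerivAt_ellipticF hk0 hk1 x)).differentiableAt
    · refine (((hasDerivAt_ellipticF hk0 hk1 _).comp_add_const x Real.pi).sub
        (hasDerivAt_ellipticF hk0 hk1 x)).deriv.trans ?_
      simp [Real.sin_add_pi]
  have h1 := h φ (-(Real.pi / 2))
  rw [ellipticF_neg, show -(Real.pi / 2) + Real.pi = Real.pi / 2 by ring] at h1
  rw [ellipticK]
  linarith

theorem ellipticK_pos {k : ℝ} (hk0 : 0 < k) (hk1 : k < 1) : 0 < ellipticK k := by
  rw [← ellipticF_zero k]
  exact ellipticF_strictMono hk0 hk1 (by positivity)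

theorem ellipticF_jacobiAm {k : ℝ} (hk0 : 0 < k) (hk1 : k < 1) (u : ℝ) :
    ellipticF k (jacobiAm k u) = u :=
  Function.rightInverse_invFun (ellipticF_bijective hk0 hk1).surjective u

theorem jacobiAm_ellipticF {k : ℝ} (hk0 : 0 < k) (hk1 : k < 1) (φ : ℝ) :
    jacobiAm k (ellipticF k φ) = φ :=
  Function.leftInverse_invFun (ellipticF_bijective hk0 hk1).injective φ

theorem jacobiAm_strictMono {k : ℝ} (hk0 : 0 < k) (hk1 : k < 1) : StrictMono (jacobiAm k) :=
  fun a b hab => by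
    rwa [← (ellipticF_strictMono hk0 hk1).lt_iff_lt, ellipticF_jacobiAm hk0 hk1,
      ellipticF_jacobiAm hk0 hk1]

theorem continuous_jacobiAm {k : ℝ} (hk0 : 0 < k) (hk1 : k < 1) : Continuous (jacobiAm k) :=
  (jacobiAm_strictMono hk0 hk1).monotone.continuous_of_surjective fun φ =>
    ⟨_, jacobiAm_ellipticF hk0 hk1 φ⟩

theorem jacobiAm_zero {k : ℝ} (hk0 : 0 < k) (hk1 : k < 1) : jacobiAm k 0 = 0 := by
  simpa [ellipticF_zero] using jacobiAm_ellipticF hk0 hk1 0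

theorem jacobiAm_ellipticK {k : ℝ} (hk0 : 0 < k) (hk1 : k < 1) :
    jacobiAm k (ellipticK k) = Real.pi / 2 := jacobiAm_ellipticF hk0 hk1 _

theorem jacobiAm_neg {k : ℝ} (hk0 : 0 < k) (hk1 : k < 1) (u : ℝ) :
    jacobiAm k (-u) = -jacobiAm k u := by
  apply (ellipticF_bijective hk0 hk1).injective
  rw [ellipticF_neg, ellipticF_jacobiAm hk0 hk1, ellipticF_jacobiAm hk0 hk1]

theorem jacobiAm_add_two_mul_ellipticK {k : ℝ} (hk0 : 0 < k) (hk1 : k < 1) (u : ℝ) :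
    jacobiAm k (u + 2 * ellipticK k) = jacobiAm k u + Real.pi := by
  apply (ellipticF_bijective hk0 hk1).injective
  rw [ellipticF_add_pi hk0 hk1, ellipticF_jacobiAm hk0 hk1, ellipticF_jacobiAm hk0 hk1]

theorem ellipticF_int_mul_pi {k : ℝ} (hk0 : 0 < k) (hk1 : k < 1) (M : ℤ) :
    ellipticF k (M * Real.pi) = 2 * ellipticK k * M := by
  induction M using Int.induction_on with
  | zero => simp [ellipticF_zero]
  | succ i ih =>
    rw [show (((i : ℤ) + 1 : ℤ) : ℝ) * Real.pi = ((i : ℤ) : ℝ) * Real.pi + Real.pi by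
      push_cast; ring, ellipticF_add_pi hk0 hk1, ih]
    push_cast; ring
  | pred i ih =>
    have h := ellipticF_add_pi hk0 hk1 (((-(i : ℤ) - 1 : ℤ) : ℝ) * Real.pi)
    rw [show ((-(i : ℤ) - 1 : ℤ) : ℝ) * Real.pi + Real.pi = ((-(i : ℤ) : ℤ) : ℝ) * Real.pi by
      push_cast; ring, ih] at h
    push_cast at h ⊢
    linarith

theorem jacobiSn_eq_zero {k : ℝ} (hk0 : 0 < k) (hk1 : k < 1) {u : ℝ} (h : jacobiSn k u = 0) :
    ∃ M : ℤ, u = 2 * ellipticK k * M := by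
  obtain ⟨M, hM⟩ := Real.sin_eq_zero_iff.1 h
  exact ⟨M, by rw [← ellipticF_int_mul_pi hk0 hk1, hM, ellipticF_jacobiAm hk0 hk1]⟩

theorem jacobiSn_sq_add_jacobiCn_sq (k u : ℝ) : jacobiSn k u ^ 2 + jacobiCn k u ^ 2 = 1 :=
  Real.sin_sq_add_cos_sq _

theorem jacobiDn_pos {k : ℝ} (hk0 : 0 < k) (hk1 : k < 1) (u : ℝ) : 0 < jacobiDn k u :=
  Real.sqrt_pos.2 (one_sub_sq_mul_sin_sq_pos hk0 hk1 _)

theorem jacobiDn_sq {k : ℝ} (hk0 : 0 < k) (hk1 : k < 1) (u : ℝ) :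
    jacobiDn k u ^ 2 = 1 - k ^ 2 * jacobiSn k u ^ 2 :=
  Real.sq_sqrt (one_sub_sq_mul_sin_sq_pos hk0 hk1 _).le

theorem jacobiSn_neg {k : ℝ} (hk0 : 0 < k) (hk1 : k < 1) (u : ℝ) :
    jacobiSn k (-u) = -jacobiSn k u := by
  rw [jacobiSn, jacobiAm_neg hk0 hk1, Real.sin_neg, jacobiSn]

theorem jacobiCn_neg {k : ℝ} (hk0 : 0 < k) (hk1 : k < 1) (u : ℝ) :
    jacobiCn k (-u) = jacobiCn k u := by
  rw [jacobiCn, jacobiAm_neg hk0 hk1, Real.cos_neg, jacobiCn]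

theorem jacobiDn_neg {k : ℝ} (hk0 : 0 < k) (hk1 : k < 1) (u : ℝ) :
    jacobiDn k (-u) = jacobiDn k u := by
  rw [jacobiDn, jacobiSn_neg hk0 hk1, neg_sq, jacobiDn]

theorem jacobiSn_zero {k : ℝ} (hk0 : 0 < k) (hk1 : k < 1) : jacobiSn k 0 = 0 := by
  rw [jacobiSn, jacobiAm_zero hk0 hk1, Real.sin_zero]

theorem jacobiCn_zero {k : ℝ} (hk0 : 0 < k) (hk1 : k < 1) : jacobiCn k 0 = 1 := by
  rw [jacobiCn, jacobiAm_zero hk0 hk1, Real.cos_zero]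

theorem jacobiDn_zero {k : ℝ} (hk0 : 0 < k) (hk1 : k < 1) : jacobiDn k 0 = 1 := by
  simp [jacobiDn, jacobiSn_zero hk0 hk1]

theorem jacobiSn_add_two_mul_ellipticK {k : ℝ} (hk0 : 0 < k) (hk1 : k < 1) (u : ℝ) :
    jacobiSn k (u + 2 * ellipticK k) = -jacobiSn k u := by
  rw [jacobiSn, jacobiAm_add_two_mul_ellipticK hk0 hk1, Real.sin_add_pi, jacobiSn]

theorem jacobiDn_add_two_mul_ellipticK {k : ℝ} (hk0 : 0 < k) (hk1 : k < 1) (u : ℝ) :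
    jacobiDn k (u + 2 * ellipticK k) = jacobiDn k u := by
  rw [jacobiDn, jacobiSn_add_two_mul_ellipticK hk0 hk1, neg_sq, jacobiDn]

theorem hasDerivAt_jacobiAm {k : ℝ} (hk0 : 0 < k) (hk1 : k < 1) (u : ℝ) :
    HasDerivAt (jacobiAm k) (jacobiDn k u) u := by
  have h := HasDerivAt.of_local_left_inverse (continuous_jacobiAm hk0 hk1).continuousAt
    (hasDerivAt_ellipticF hk0 hk1 (jacobiAm k u))
    (one_div_pos.2 (Real.sqrt_pos.2 (one_sub_sq_mul_sin_sq_pos hk0 hk1 _))).ne'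
    (Filter.Eventually.of_forall fun y => ellipticF_jacobiAm hk0 hk1 y)
  simpa [jacobiDn, jacobiSn] using h

theorem hasDerivAt_jacobiSn {k : ℝ} (hk0 : 0 < k) (hk1 : k < 1) (u : ℝ) :
    HasDerivAt (jacobiSn k) (jacobiCn k u * jacobiDn k u) u :=
  (hasDerivAt_jacobiAm hk0 hk1 u).sin

theorem hasDerivAt_jacobiCn {k : ℝ} (hk0 : 0 < k) (hk1 : k < 1) (u : ℝ) :
    HasDerivAt (jacobiCn k) (-jacobiSn k u * jacobiDn k u) u :=
  (hasDerivAt_jacobiAm hk0 hk1 u).cos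

theorem hasDerivAt_jacobiDn {k : ℝ} (hk0 : 0 < k) (hk1 : k < 1) (u : ℝ) :
    HasDerivAt (jacobiDn k) (-(k ^ 2 * jacobiSn k u * jacobiCn k u)) u := by
  have h := ((((hasDerivAt_jacobiSn hk0 hk1 u).pow 2).const_mul (k ^ 2)).const_sub 1).sqrt
    (one_sub_sq_mul_sin_sq_pos hk0 hk1 _).ne'
  refine h.congr_deriv ?_
  have hd := jacobiDn_pos hk0 hk1 u
  change _ / (2 * jacobiDn k u) = _
  field_simp
  simp
  ring

/-! ### Addition theorems and the identities derived from them. -/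

theorem jacobiSn_sq_le_one (k u : ℝ) : jacobiSn k u ^ 2 ≤ 1 := Real.sin_sq_le_one _

theorem one_sub_sq_mul_jacobiSn_sq_mul_pos {k : ℝ} (hk0 : 0 < k) (hk1 : k < 1) (u v : ℝ) :
    0 < 1 - k ^ 2 * jacobiSn k u ^ 2 * jacobiSn k v ^ 2 := by
  have h1 := one_sub_sq_mul_sin_sq_pos hk0 hk1 (jacobiAm k u)
  have h2 := jacobiSn_sq_le_one k v
  change 0 < 1 - k ^ 2 * jacobiSn k u ^ 2 at h1
  nlinarith [mul_nonneg (mul_nonneg (sq_nonneg k) (sq_nonneg (jacobiSn k u))) (sub_nonneg.2 h2)]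

/-- Along the line `u + v = t` the addition quotient has zero derivative, so it equals its value at
`u = 0`. The denominator is multiplied out to keep later uses polynomial. The formulas for `cn` and
`dn` are obtained in the same way. -/
theorem jacobiSn_add {k : ℝ} (hk0 : 0 < k) (hk1 : k < 1) (u v : ℝ) :
    jacobiSn k (u + v) * (1 - k ^ 2 * jacobiSn k u ^ 2 * jacobiSn k v ^ 2) =
      jacobiSn k u * jacobiCn k v * jacobiDn k v + jacobiSn k v * jacobiCn k u * jacobiDn k u := by
  set t := u + v with ht
  let f : ℝ → ℝ := fun x => (jacobiSn k x * jacobiCn k (t - x) * jacobiDn k (t - x) +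
    jacobiSn k (t - x) * jacobiCn k x * jacobiDn k x) /
      (1 - k ^ 2 * jacobiSn k x ^ 2 * jacobiSn k (t - x) ^ 2)
  have hf : ∀ x, HasDerivAt f 0 x := fun x => by
    have hD := (one_sub_sq_mul_jacobiSn_sq_mul_pos hk0 hk1 x (t - x)).ne'
    have s1 := hasDerivAt_jacobiSn hk0 hk1 x
    have c1 := hasDerivAt_jacobiCn hk0 hk1 x
    have d1 := hasDerivAt_jacobiDn hk0 hk1 x
    have s2 := (hasDerivAt_jacobiSn hk0 hk1 (t - x)).comp_const_sub t x
    have c2 := (hasDerivAt_jacobiCn hk0 hk1 (t - x)).comp_const_sub t x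
    have d2 := (hasDerivAt_jacobiDn hk0 hk1 (t - x)).comp_const_sub t x
    refine ((((s1.mul c2).mul d2).add ((s2.mul c1).mul d1)).div
      ((((s1.pow 2).const_mul (k ^ 2)).mul (s2.pow 2)).const_sub 1) hD).congr_deriv ?_
    have e1 := jacobiSn_sq_add_jacobiCn_sq k x
    have e2 := jacobiSn_sq_add_jacobiCn_sq k (t - x)
    have e3 := jacobiDn_sq hk0 hk1 x
    have e4 := jacobiDn_sq hk0 hk1 (t - x)
    simp only [Pi.mul_apply, Pi.pow_apply, Pi.add_apply]
    refine div_eq_zero_iff.2 (Or.inl ?_)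
    push_cast
    -- The numerator of the derivative vanishes modulo `s² + c² = 1`, `d² = 1 - k²s²` and their
    -- copies at `t - x`: a purely polynomial question.
    generalize jacobiSn k x = s at *
    generalize jacobiCn k x = c at *
    generalize jacobiDn k x = d at *
    generalize jacobiSn k (t - x) = S at *
    generalize jacobiCn k (t - x) = C at *
    generalize jacobiDn k (t - x) = D at *
    clear s1 c1 d1 s2 c2 d2 hD
    grind
  have h := is_const_of_deriv_eq_zero (fun x => (hf x).differentiableAt) (fun x => (hf x).deriv) u 0
  have hD := (one_sub_sq_mul_jacobiSn_sq_mul_pos hk0 hk1 u v).ne'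
  simp only [f, show t - u = v by rw [ht]; ring, sub_zero, jacobiSn_zero hk0 hk1,
    jacobiCn_zero hk0 hk1, jacobiDn_zero hk0 hk1] at h
  rw [div_eq_iff hD] at h
  rw [h]
  simp

theorem jacobiCn_add {k : ℝ} (hk0 : 0 < k) (hk1 : k < 1) (u v : ℝ) :
    jacobiCn k (u + v) * (1 - k ^ 2 * jacobiSn k u ^ 2 * jacobiSn k v ^ 2) =
      jacobiCn k u * jacobiCn k v - jacobiSn k u * jacobiSn k v * jacobiDn k u * jacobiDn k v := by
  set t := u + v with ht
  let f : ℝ → ℝ := fun x => (jacobiCn k x * jacobiCn k (t - x) -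
    jacobiSn k x * jacobiSn k (t - x) * jacobiDn k x * jacobiDn k (t - x)) /
      (1 - k ^ 2 * jacobiSn k x ^ 2 * jacobiSn k (t - x) ^ 2)
  have hf : ∀ x, HasDerivAt f 0 x := fun x => by
    have hD := (one_sub_sq_mul_jacobiSn_sq_mul_pos hk0 hk1 x (t - x)).ne'
    have s1 := hasDerivAt_jacobiSn hk0 hk1 x
    have c1 := hasDerivAt_jacobiCn hk0 hk1 x
    have d1 := hasDerivAt_jacobiDn hk0 hk1 x
    have s2 := (hasDerivAt_jacobiSn hk0 hk1 (t - x)).comp_const_sub t x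
    have c2 := (hasDerivAt_jacobiCn hk0 hk1 (t - x)).comp_const_sub t x
    have d2 := (hasDerivAt_jacobiDn hk0 hk1 (t - x)).comp_const_sub t x
    refine (((c1.mul c2).sub (((s1.mul s2).mul d1).mul d2)).div
      ((((s1.pow 2).const_mul (k ^ 2)).mul (s2.pow 2)).const_sub 1) hD).congr_deriv ?_
    have e1 := jacobiSn_sq_add_jacobiCn_sq k x
    have e2 := jacobiSn_sq_add_jacobiCn_sq k (t - x)
    have e3 := jacobiDn_sq hk0 hk1 x
    have e4 := jacobiDn_sq hk0 hk1 (t - x)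
    simp only [Pi.mul_apply, Pi.pow_apply, Pi.sub_apply]
    refine div_eq_zero_iff.2 (Or.inl ?_)
    push_cast
    generalize jacobiSn k x = s at *
    generalize jacobiCn k x = c at *
    generalize jacobiDn k x = d at *
    generalize jacobiSn k (t - x) = S at *
    generalize jacobiCn k (t - x) = C at *
    generalize jacobiDn k (t - x) = D at *
    clear s1 c1 d1 s2 c2 d2 hD
    grind
  have h := is_const_of_deriv_eq_zero (fun x => (hf x).differentiableAt) (fun x => (hf x).deriv) u 0
  have hD := (one_sub_sq_mul_jacobiSn_sq_mul_pos hk0 hk1 u v).ne'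
  simp only [f, show t - u = v by rw [ht]; ring, sub_zero, jacobiSn_zero hk0 hk1,
    jacobiCn_zero hk0 hk1, jacobiDn_zero hk0 hk1] at h
  rw [div_eq_iff hD] at h
  rw [h]
  simp

theorem jacobiDn_add {k : ℝ} (hk0 : 0 < k) (hk1 : k < 1) (u v : ℝ) :
    jacobiDn k (u + v) * (1 - k ^ 2 * jacobiSn k u ^ 2 * jacobiSn k v ^ 2) =
      jacobiDn k u * jacobiDn k v - k ^ 2 * jacobiSn k u * jacobiSn k v * jacobiCn k u *
        jacobiCn k v := by
  set t := u + v with ht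
  let f : ℝ → ℝ := fun x => (jacobiDn k x * jacobiDn k (t - x) -
    k ^ 2 * jacobiSn k x * jacobiSn k (t - x) * jacobiCn k x * jacobiCn k (t - x)) /
      (1 - k ^ 2 * jacobiSn k x ^ 2 * jacobiSn k (t - x) ^ 2)
  have hf : ∀ x, HasDerivAt f 0 x := fun x => by
    have hD := (one_sub_sq_mul_jacobiSn_sq_mul_pos hk0 hk1 x (t - x)).ne'
    have s1 := hasDerivAt_jacobiSn hk0 hk1 x
    have c1 := hasDerivAt_jacobiCn hk0 hk1 x
    have d1 := hasDerivAt_jacobiDn hk0 hk1 x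
    have s2 := (hasDerivAt_jacobiSn hk0 hk1 (t - x)).comp_const_sub t x
    have c2 := (hasDerivAt_jacobiCn hk0 hk1 (t - x)).comp_const_sub t x
    have d2 := (hasDerivAt_jacobiDn hk0 hk1 (t - x)).comp_const_sub t x
    refine (((d1.mul d2).sub ((((s1.const_mul (k ^ 2)).mul s2).mul c1).mul c2)).div
      ((((s1.pow 2).const_mul (k ^ 2)).mul (s2.pow 2)).const_sub 1) hD).congr_deriv ?_
    have e1 := jacobiSn_sq_add_jacobiCn_sq k x
    have e2 := jacobiSn_sq_add_jacobiCn_sq k (t - x)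
    have e3 := jacobiDn_sq hk0 hk1 x
    have e4 := jacobiDn_sq hk0 hk1 (t - x)
    simp only [Pi.mul_apply, Pi.pow_apply, Pi.sub_apply]
    refine div_eq_zero_iff.2 (Or.inl ?_)
    push_cast
    generalize jacobiSn k x = s at *
    generalize jacobiCn k x = c at *
    generalize jacobiDn k x = d at *
    generalize jacobiSn k (t - x) = S at *
    generalize jacobiCn k (t - x) = C at *
    generalize jacobiDn k (t - x) = D at *
    clear s1 c1 d1 s2 c2 d2 hD
    grind
  have h := is_const_of_deriv_eq_zero (fun x => (hf x).differentiableAt) (fun x => (hf x).deriv) u 0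
  have hD := (one_sub_sq_mul_jacobiSn_sq_mul_pos hk0 hk1 u v).ne'
  simp only [f, show t - u = v by rw [ht]; ring, sub_zero, jacobiSn_zero hk0 hk1,
    jacobiCn_zero hk0 hk1, jacobiDn_zero hk0 hk1] at h
  rw [div_eq_iff hD] at h
  rw [h]
  simp

/-- With its companion for `cn`, this is what makes the Szegő recurrence for the moments preserve a
product form: each step trades `dn` for `cn`, or back, and releases one factor `sn u`. -/
theorem jacobiDn_sub_sub {k : ℝ} (hk0 : 0 < k) (hk1 : k < 1) (u v : ℝ) :
    jacobiDn k (u - v) - jacobiDn k u * jacobiDn k v =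
      k ^ 2 * jacobiSn k u * jacobiSn k v * jacobiCn k (u - v) := by
  have h1 := jacobiDn_add hk0 hk1 u (-v)
  have h2 := jacobiCn_add hk0 hk1 u (-v)
  have hD := (one_sub_sq_mul_jacobiSn_sq_mul_pos hk0 hk1 u (-v)).ne'
  rw [← sub_eq_add_neg] at h1 h2
  refine mul_right_cancel₀ hD ?_
  rw [sub_mul, h1, mul_assoc (k ^ 2 * jacobiSn k u * jacobiSn k v), h2]
  simp only [jacobiSn_neg hk0 hk1, jacobiCn_neg hk0 hk1, jacobiDn_neg hk0 hk1]
  ring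

theorem jacobiCn_sub_sub {k : ℝ} (hk0 : 0 < k) (hk1 : k < 1) (u v : ℝ) :
    jacobiCn k (u - v) - jacobiCn k u * jacobiCn k v =
      jacobiSn k u * jacobiSn k v * jacobiDn k (u - v) := by
  have h1 := jacobiDn_add hk0 hk1 u (-v)
  have h2 := jacobiCn_add hk0 hk1 u (-v)
  have hD := (one_sub_sq_mul_jacobiSn_sq_mul_pos hk0 hk1 u (-v)).ne'
  rw [← sub_eq_add_neg] at h1 h2
  refine mul_right_cancel₀ hD ?_
  rw [sub_mul, h2, mul_assoc (jacobiSn k u * jacobiSn k v), h1]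
  simp only [jacobiSn_neg hk0 hk1, jacobiCn_neg hk0 hk1, jacobiDn_neg hk0 hk1]
  ring

/-- This and the next identity play the role of Pascal's rule for the coefficients; there `u + v =
w(n+1)`, so `dn (u + v)` or `cn (u + v)` is a reflection parameter up to sign. -/
theorem jacobiDn_mul_jacobiSn_add {k : ℝ} (hk0 : 0 < k) (hk1 : k < 1) (u v : ℝ) :
    jacobiDn k v * jacobiSn k (u + v) =
      jacobiCn k v * jacobiSn k u + jacobiDn k (u + v) * jacobiCn k u * jacobiSn k v := by
  have h1 := jacobiDn_add hk0 hk1 u v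
  have h2 := jacobiSn_add hk0 hk1 u v
  have e1 := jacobiSn_sq_add_jacobiCn_sq k u
  have e4 := jacobiDn_sq hk0 hk1 v
  refine mul_right_cancel₀ (one_sub_sq_mul_jacobiSn_sq_mul_pos hk0 hk1 u v).ne' ?_
  linear_combination jacobiDn k v * h2 - jacobiCn k u * jacobiSn k v * h1 +
    jacobiSn k u * jacobiCn k v * e4 + k ^ 2 * jacobiSn k u * jacobiSn k v ^ 2 * jacobiCn k v * e1

theorem jacobiCn_mul_jacobiSn_add {k : ℝ} (hk0 : 0 < k) (hk1 : k < 1) (u v : ℝ) :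
    jacobiCn k v * jacobiSn k (u + v) =
      jacobiDn k v * jacobiSn k u + jacobiCn k (u + v) * jacobiDn k u * jacobiSn k v := by
  have h1 := jacobiCn_add hk0 hk1 u v
  have h2 := jacobiSn_add hk0 hk1 u v
  have e2 := jacobiSn_sq_add_jacobiCn_sq k v
  have e3 := jacobiDn_sq hk0 hk1 u
  refine mul_right_cancel₀ (one_sub_sq_mul_jacobiSn_sq_mul_pos hk0 hk1 u v).ne' ?_
  linear_combination jacobiCn k v * h2 - jacobiDn k u * jacobiSn k v * h1 +
    jacobiSn k u * jacobiDn k v * e2 + jacobiSn k u * jacobiSn k v ^ 2 * jacobiDn k v * e3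

/-! ### Szegő recurrence and shifted moments. -/

/-- The monic polynomials generated by the Szegő recurrence with real reflection parameters `a`. -/
noncomputable def szegoPoly (a : ℕ → ℝ) : ℕ → ℝ[X]
  | 0 => 1
  | n + 1 => X * szegoPoly a n - C (a n) * (szegoPoly a n).reflect n

theorem szegoPoly_natDegree_le_and_coeff (a : ℕ → ℝ) (n : ℕ) :
    (szegoPoly a n).natDegree ≤ n ∧ (szegoPoly a n).coeff n = 1 := by
  induction n with
  | zero => simp [szegoPoly]
  | succ n ih =>
    constructor
    · rw [natDegree_le_iff_coeff_eq_zero]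
      intro N hN
      obtain ⟨M, rfl⟩ := Nat.exists_eq_add_of_lt hN
      -- `reflect n` leaves coefficients above index `n` in place, and these are zero by the degree
      -- bound.
      rw [szegoPoly, coeff_sub, coeff_X_mul, coeff_C_mul, coeff_reflect,
        revAt_eq_self_of_lt (by lia), coeff_eq_zero_of_natDegree_lt (by lia),
        coeff_eq_zero_of_natDegree_lt (by lia)]
      simp
    · rw [szegoPoly, coeff_sub, coeff_X_mul, coeff_C_mul, coeff_reflect,
        revAt_eq_self_of_lt (by lia), ih.2, coeff_eq_zero_of_natDegree_lt (n := n + 1) (by lia)]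
      simp

theorem szegoPoly_coeff_zero (a : ℕ → ℝ) (n : ℕ) : (szegoPoly a (n + 1)).coeff 0 = -a n := by
  rw [szegoPoly, coeff_sub, coeff_X_mul_zero, coeff_C_mul, coeff_reflect, revAt_zero,
    (szegoPoly_natDegree_le_and_coeff a n).2]
  ring

theorem szegoPoly_coeff_succ (a : ℕ → ℝ) {n s : ℕ} (hs : s + 1 ≤ n) :
    (szegoPoly a (n + 1)).coeff (s + 1) =
      (szegoPoly a n).coeff s - a n * (szegoPoly a n).coeff (n - (s + 1)) := by
  rw [szegoPoly, coeff_sub, coeff_X_mul, coeff_C_mul, coeff_reflect, revAt_le hs]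

/-- The moment `L{p(z) z^{-j}}`. -/
noncomputable def shiftedMoment (c : ℤ → ℝ) (p : ℝ[X]) (j : ℤ) : ℝ :=
  ∑ s ∈ Finset.range (p.natDegree + 1), p.coeff s * c (s - j)

theorem shiftedMoment_eq_sum (c : ℤ → ℝ) {p : ℝ[X]} {n : ℕ} (hp : p.natDegree ≤ n) (j : ℤ) :
    shiftedMoment c p j = ∑ s ∈ Finset.range (n + 1), p.coeff s * c (s - j) := by
  refine Finset.sum_subset (Finset.range_mono (by lia)) fun s _ hs => ?_
  rw [coeff_eq_zero_of_natDegree_lt (by simpa using hs), zero_mul]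

/-- Reversing the coefficients of `p` turns `z^{s-j}` into `z^{n-s-j}`; evenness of `c` flips the
sign of the exponent, which gives the shift `n - j` for the same `p`. -/
theorem shiftedMoment_szegoPoly_succ {c : ℤ → ℝ} (hc : ∀ n, c (-n) = c n) (a : ℕ → ℝ) (n : ℕ)
    (j : ℤ) : shiftedMoment c (szegoPoly a (n + 1)) j =
      shiftedMoment c (szegoPoly a n) (j - 1) - a n * shiftedMoment c (szegoPoly a n) (n - j) := by
  have h1 := (szegoPoly_natDegree_le_and_coeff a n).1
  rw [shiftedMoment_eq_sum c (szegoPoly_natDegree_le_and_coeff a (n + 1)).1,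
    shiftedMoment_eq_sum c h1, shiftedMoment_eq_sum c h1]
  have h2 : ∀ s, (szegoPoly a (n + 1)).coeff s * c (s - j) =
      (X * szegoPoly a n).coeff s * c (s - j) -
        a n * (((szegoPoly a n).reflect n).coeff s * c (s - j)) := fun s => by
    rw [szegoPoly, coeff_sub, coeff_C_mul]
    ring
  simp only [h2]
  rw [Finset.sum_sub_distrib, ← Finset.mul_sum]
  congr 1
  · rw [Finset.sum_range_succ']
    simp only [coeff_X_mul, coeff_X_mul_zero, zero_mul, add_zero]
    refine Finset.sum_congr rfl fun s _ => ?_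
    congr 2
    push_cast
    ring
  · congr 1
    rw [Finset.sum_range_succ, coeff_reflect, revAt_eq_self_of_lt (by lia),
      coeff_eq_zero_of_natDegree_lt (n := n + 1) (by lia), zero_mul, add_zero,
      ← Finset.sum_range_reflect]
    refine Finset.sum_congr rfl fun s hs => ?_
    have hs' : s ≤ n := by simpa [Nat.lt_succ_iff] using hs
    rw [coeff_reflect, show n + 1 - 1 - s = n - s by lia, revAt_le (by lia),
      show n - (n - s) = s by lia, ← hc]
    congr 2
    push_cast [hs']
    ring

/-! ### Determinants from orthogonality. -/

/-- Take the last component of `adj(M) M v = det(M) v`: only the last entry of `M v` contributes,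
weighted by a principal minor. A general ring is needed, since the lemma serves both the real
Toeplitz matrix and the polynomial matrix with last row `1, z, …, z^n`. -/
theorem det_eq_mulVec_last_mul_det {R : Type*} [CommRing R] {n : ℕ}
    (M : Matrix (Fin (n + 1)) (Fin (n + 1)) R) (v : Fin (n + 1) → R) (hv : v (Fin.last n) = 1)
    (hM : ∀ i : Fin n, M.mulVec v i.castSucc = 0) :
    M.det = M.mulVec v (Fin.last n) * (M.submatrix Fin.castSucc Fin.castSucc).det := by
  have h := congrFun (congrArg (fun A => A.mulVec v) (M.adjugate_mul)) (Fin.last n)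
  simp only [← Matrix.mulVec_mulVec, Matrix.smul_mulVec, Matrix.one_mulVec, Pi.smul_apply, hv,
    smul_eq_mul, mul_one] at h
  rw [← h, Matrix.mulVec, dotProduct, Fin.sum_univ_castSucc]
  simp only [hM, mul_zero, Finset.sum_const_zero, zero_add]
  rw [Matrix.adjugate_fin_succ_eq_det_submatrix, mul_comm]
  simp [← two_mul, pow_mul, Fin.succAbove_last]

section Toeplitz

variable {c : ℤ → ℝ} {p : ℝ[X]} {n : ℕ}

theorem toeplitzDet_succ_eq (hp : p.natDegree ≤ n) (hp1 : p.coeff n = 1)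
    (h : ∀ j : ℕ, j < n → shiftedMoment c p j = 0) :
    toeplitzDet c (n + 1) = shiftedMoment c p n * toeplitzDet c n := by
  have hmul : ∀ i : Fin (n + 1), (Matrix.of fun i j : Fin (n + 1) => c ((j : ℤ) - (i : ℤ))).mulVec
      (fun s => p.coeff s) i = shiftedMoment c p (i : ℕ) := fun i => by
    rw [shiftedMoment_eq_sum c hp, Finset.sum_range, Matrix.mulVec, dotProduct]
    exact Finset.sum_congr rfl fun s _ => mul_comm _ _
  rw [toeplitzDet, det_eq_mulVec_last_mul_det _ (fun s => p.coeff s) (by simpa using hp1)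
    (fun i => by rw [hmul]; exact h _ i.2), hmul]
  rfl

/-- The first `n` rows applied to the coefficient vector of `p` give the moments assumed to vanish,
while the last row gives `p` itself. -/
theorem circlePoly_eq (hΔ : toeplitzDet c n ≠ 0) (hp : p.natDegree ≤ n) (hp1 : p.coeff n = 1)
    (h : ∀ j : ℕ, j < n → shiftedMoment c p j = 0) : circlePoly c n = p := by
  rw [circlePoly, det_eq_mulVec_last_mul_det _ (fun s => C (p.coeff s)) (by simp [hp1])]
  · have h1 : Matrix.mulVec (Matrix.of fun i j : Fin (n + 1) =>
        if (i : ℕ) < n then C (c ((j : ℤ) - (i : ℤ))) else (X : ℝ[X]) ^ (j : ℕ))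
        (fun s => C (p.coeff s)) (Fin.last n) = p := by
      conv_rhs => rw [p.as_sum_range_C_mul_X_pow' (Nat.lt_succ_of_le hp), Finset.sum_range]
      rw [Matrix.mulVec, dotProduct]
      refine Finset.sum_congr rfl fun s _ => ?_
      rw [Matrix.of_apply, if_neg (by simp), mul_comm]
    have h2 : Matrix.det (Matrix.submatrix (Matrix.of fun i j : Fin (n + 1) =>
        if (i : ℕ) < n then C (c ((j : ℤ) - (i : ℤ))) else (X : ℝ[X]) ^ (j : ℕ))
        Fin.castSucc Fin.castSucc) = C (toeplitzDet c n) := by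
      rw [toeplitzDet, RingHom.map_det]
      congr 1
      ext1 i j
      simp
    rw [h1, h2, mul_left_comm, ← C_mul, inv_mul_cancel₀ hΔ, C_1, mul_one]
  · intro i
    have h3 := congrArg C (h i i.2)
    rw [shiftedMoment_eq_sum c hp, Finset.sum_range, map_sum, C_0] at h3
    rw [← h3, Matrix.mulVec, dotProduct]
    refine Finset.sum_congr rfl fun s _ => ?_
    simp [mul_comm]

end Toeplitz

/-! ### The moment functional in terms of shifted moments. -/

open LaurentPolynomial in
theorem momentFunctional_T (c : ℤ → ℝ) (n : ℤ) : momentFunctional c (T n) = c n := by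
  rw [momentFunctional, LinearMap.comp_apply]
  erw [Finsupp.linearCombination_single]
  simp

open LaurentPolynomial in
theorem toLaurent_mul_invert_toLaurent {n m : ℕ} {p q : ℝ[X]} (hp : p.natDegree ≤ n)
    (hq : q.natDegree ≤ m) : toLaurent p * LaurentPolynomial.invert (toLaurent q) =
      ∑ i ∈ Finset.range (m + 1), ∑ s ∈ Finset.range (n + 1),
        (q.coeff i * p.coeff s) • (T ((s : ℤ) - i) : ℝ[T;T⁻¹]) := by
  conv_lhs => rw [p.as_sum_range_C_mul_X_pow' (Nat.lt_succ_of_le hp),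
    q.as_sum_range_C_mul_X_pow' (Nat.lt_succ_of_le hq)]
  simp only [map_sum, map_mul, LaurentPolynomial.invert_T,
    LaurentPolynomial.invert_C, map_pow, Polynomial.toLaurent_C, Polynomial.toLaurent_X,
    LaurentPolynomial.T_pow, Finset.sum_mul_sum]
  rw [Finset.sum_comm]
  refine Finset.sum_congr rfl fun i _ => Finset.sum_congr rfl fun s _ => ?_
  rw [LaurentPolynomial.smul_eq_C_mul, sub_eq_add_neg, LaurentPolynomial.T_add, map_mul]
  simp only [mul_one]
  ring

theorem momentFunctional_mul_invert (c : ℤ → ℝ) {m : ℕ} {p q : ℝ[X]} (hq : q.natDegree ≤ m) :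
    momentFunctional c (toLaurent p * LaurentPolynomial.invert (toLaurent q)) =
      ∑ i ∈ Finset.range (m + 1), q.coeff i * shiftedMoment c p i := by
  rw [toLaurent_mul_invert_toLaurent le_rfl hq]
  simp only [map_sum, map_smul, momentFunctional_T, shiftedMoment, Finset.mul_sum, smul_eq_mul,
    mul_assoc]

theorem momentFunctional_mul_invert_comm {c : ℤ → ℝ} (hc : ∀ n, c (-n) = c n) (p q : ℝ[X]) :
    momentFunctional c (toLaurent p * LaurentPolynomial.invert (toLaurent q)) =
      momentFunctional c (toLaurent q * LaurentPolynomial.invert (toLaurent p)) := by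
  rw [toLaurent_mul_invert_toLaurent le_rfl le_rfl, toLaurent_mul_invert_toLaurent le_rfl le_rfl,
    Finset.sum_comm]
  simp only [map_sum, map_smul, momentFunctional_T, smul_eq_mul]
  refine Finset.sum_congr rfl fun i _ => Finset.sum_congr rfl fun s _ => ?_
  rw [← hc, neg_sub, mul_comm (q.coeff s)]

/-! ### Orthogonality for the moments `dn(wn)`. -/

/-- The reflection parameters of the moments `dn(w n; k)`. -/
noncomputable def dnReflection (k w : ℝ) (n : ℕ) : ℝ :=
  if Even n then jacobiDn k (w * (n + 1)) else -jacobiCn k (w * (n + 1))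

theorem jacobiSn_mul_int_ne_zero {k w : ℝ} (hk0 : 0 < k) (hk1 : k < 1)
    (hw : ∀ M N : ℤ, N ≠ 0 → w ≠ 2 * ellipticK k * M / N) {N : ℤ} (hN : N ≠ 0) :
    jacobiSn k (w * N) ≠ 0 := fun h => by
  obtain ⟨M, hM⟩ := jacobiSn_eq_zero hk0 hk1 h
  exact hw M N hN (by rw [← hM]; field_simp)

theorem jacobiSn_mul_nat_succ_ne_zero {k w : ℝ} (hk0 : 0 < k) (hk1 : k < 1)
    (hw : ∀ M N : ℤ, N ≠ 0 → w ≠ 2 * ellipticK k * M / N) (n : ℕ) :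
    jacobiSn k (w * (n + 1)) ≠ 0 := by
  simpa using jacobiSn_mul_int_ne_zero hk0 hk1 hw (N := n + 1) (by lia)

theorem abs_dnReflection_lt_one {k w : ℝ} (hk0 : 0 < k) (hk1 : k < 1)
    (hw : ∀ M N : ℤ, N ≠ 0 → w ≠ 2 * ellipticK k * M / N) (n : ℕ) :
    |dnReflection k w n| < 1 := by
  have hs := jacobiSn_mul_nat_succ_ne_zero hk0 hk1 hw n
  rw [← sq_lt_one_iff_abs_lt_one, dnReflection]
  split_ifs
  · rw [jacobiDn_sq hk0 hk1]
    have : 0 < k ^ 2 * jacobiSn k (w * (n + 1)) ^ 2 := by positivity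
    linarith
  · have := jacobiSn_sq_add_jacobiCn_sq k (w * (n + 1))
    have : 0 < jacobiSn k (w * (n + 1)) ^ 2 := by positivity
    rw [neg_sq]
    linarith

theorem dnMoment_neg {k : ℝ} (hk0 : 0 < k) (hk1 : k < 1) (w : ℝ) (n : ℤ) :
    dnMoment k w (-n) = dnMoment k w n := by
  rw [dnMoment, Int.cast_neg, mul_neg, jacobiDn_neg hk0 hk1, dnMoment]

/-- The index `j` ranges over all integers because the recurrence mixes `j - 1` with `n - j`. The
constant `A` need not be known: only the zeros at `0 ≤ j < n` are used afterwards. -/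
theorem shiftedMoment_szegoPoly_dnReflection {k : ℝ} (hk0 : 0 < k) (hk1 : k < 1) (w : ℝ) (n : ℕ) :
    ∃ A : ℝ, ∀ j : ℤ, shiftedMoment (dnMoment k w) (szegoPoly (dnReflection k w) n) j =
      A * (∏ i ∈ Finset.range n, jacobiSn k (w * (j - i))) *
        if Even n then jacobiDn k (w * (j - n)) else jacobiCn k (w * (j - n)) := by
  induction n with
  | zero =>
    refine ⟨1, fun j => ?_⟩
    simp only [shiftedMoment, szegoPoly, natDegree_one, zero_add, Finset.sum_range_one,
      coeff_one_zero, Finset.range_zero, Finset.prod_empty, Even.zero, if_true, dnMoment]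
    rw [one_mul, one_mul, one_mul, Int.cast_sub, ← jacobiDn_neg hk0 hk1]
    congr 1
    push_cast
    ring
  | succ n ih =>
    obtain ⟨A, hA⟩ := ih
    have hP1 : ∀ j : ℤ, ∏ i ∈ Finset.range n, jacobiSn k (w * ((j - 1 : ℤ) - i)) =
        ∏ i ∈ Finset.range n, jacobiSn k (w * (j - (i + 1 : ℕ))) := fun j =>
      Finset.prod_congr rfl fun i _ => by push_cast; ring_nf
    -- Reversing the product and using oddness of `sn` gives the sign `(-1)^n`; the minus sign
    -- carried by `a_n` for odd `n` compensates it.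
    have hP2 : ∀ j : ℤ, ∏ i ∈ Finset.range n, jacobiSn k (w * ((n - j : ℤ) - i)) =
        (-1) ^ n * ∏ i ∈ Finset.range n, jacobiSn k (w * (j - (i + 1 : ℕ))) := fun j => by
      rw [← Finset.prod_range_reflect, show (-1 : ℝ) ^ n = ∏ _i ∈ Finset.range n, (-1 : ℝ) by simp,
        ← Finset.prod_mul_distrib]
      refine Finset.prod_congr rfl fun i hi => ?_
      have hi' : i + 1 ≤ n := Finset.mem_range.1 hi
      rw [neg_one_mul, ← jacobiSn_neg hk0 hk1, Nat.sub_sub, add_comm 1 i, Nat.cast_sub hi']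
      congr 1
      push_cast
      ring
    -- Of the product `sn u · sn v` released by the subtraction identity, with `u = wj` and `v =
    -- w(n+1)`, the factor `sn v` goes into the constant and `sn u` is the new `i = 0` factor.
    refine ⟨A * ((if Even n then k ^ 2 else 1) * jacobiSn k (w * (n + 1))), fun j => ?_⟩
    rw [shiftedMoment_szegoPoly_succ (dnMoment_neg hk0 hk1 w), hA, hA, hP1, hP2,
      Finset.prod_range_succ']
    have e1 : w * ((j - 1 : ℤ) - n : ℝ) = w * j - w * (n + 1) := by push_cast; ring
    have e2 : w * ((n - j : ℤ) - n : ℝ) = -(w * j) := by push_cast; ring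
    have e3 : w * (j - (n + 1 : ℕ) : ℝ) = w * j - w * (n + 1) := by push_cast; ring
    rw [e1, e2, e3, jacobiDn_neg hk0 hk1, jacobiCn_neg hk0 hk1, dnReflection, Nat.cast_zero,
      sub_zero]
    by_cases hn : Even n
    · have hn' : ¬Even (n + 1) := by simpa [Nat.even_add_one] using hn
      rw [if_pos hn, if_pos hn, if_pos hn, if_neg hn', if_pos hn, hn.neg_one_pow]
      linear_combination A * (∏ i ∈ Finset.range n, jacobiSn k (w * (j - (i + 1 : ℕ)))) *
        jacobiDn_sub_sub hk0 hk1 (w * j) (w * (n + 1))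
    · have hn' : Even (n + 1) := Nat.even_add_one.2 hn
      rw [if_neg hn, if_neg hn, if_neg hn, if_pos hn', if_neg hn,
        (Nat.not_even_iff_odd.1 hn).neg_one_pow]
      linear_combination A * (∏ i ∈ Finset.range n, jacobiSn k (w * (j - (i + 1 : ℕ)))) *
        jacobiCn_sub_sub hk0 hk1 (w * j) (w * (n + 1))

theorem shiftedMoment_szegoPoly_eq_zero {k : ℝ} (hk0 : 0 < k) (hk1 : k < 1) (w : ℝ) {n j : ℕ}
    (hj : j < n) : shiftedMoment (dnMoment k w) (szegoPoly (dnReflection k w) n) j = 0 := by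
  obtain ⟨A, hA⟩ := shiftedMoment_szegoPoly_dnReflection hk0 hk1 w n
  rw [hA, Finset.prod_eq_zero (Finset.mem_range.2 hj) (by simp [jacobiSn_zero hk0 hk1])]
  simp

/-- Vanishing of the moment of `P_{n+1}` at `j = 0` expresses the moment of `P_n` at `-1` as `a_n`
times the one at `n`. Inserting this in the recurrence at `j = n + 1` gives the factor `1 - a_n²`.
-/
theorem shiftedMoment_szegoPoly_self {k : ℝ} (hk0 : 0 < k) (hk1 : k < 1) (w : ℝ) (n : ℕ) :
    shiftedMoment (dnMoment k w) (szegoPoly (dnReflection k w) n) n =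
      ∏ i ∈ Finset.range n, (1 - dnReflection k w i ^ 2) := by
  induction n with
  | zero => simp [shiftedMoment, szegoPoly, dnMoment, jacobiDn_zero hk0 hk1]
  | succ n ih =>
    have h0 := shiftedMoment_szegoPoly_eq_zero hk0 hk1 w n.succ_pos
    rw [shiftedMoment_szegoPoly_succ (dnMoment_neg hk0 hk1 w)] at h0 ⊢
    simp only [Nat.cast_zero, zero_sub, sub_zero] at h0
    rw [show ((n + 1 : ℕ) : ℤ) - 1 = n by simp, show (n : ℤ) - (n + 1 : ℕ) = -1 by simp,
      Finset.prod_range_succ, ← ih]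
    linear_combination -dnReflection k w n * h0

theorem shiftedMoment_szegoPoly_self_pos {k w : ℝ} (hk0 : 0 < k) (hk1 : k < 1)
    (hw : ∀ M N : ℤ, N ≠ 0 → w ≠ 2 * ellipticK k * M / N) (n : ℕ) :
    0 < shiftedMoment (dnMoment k w) (szegoPoly (dnReflection k w) n) n := by
  rw [shiftedMoment_szegoPoly_self hk0 hk1]
  exact Finset.prod_pos fun i _ => sub_pos.2 <|
    (sq_lt_one_iff_abs_lt_one _).2 (abs_dnReflection_lt_one hk0 hk1 hw i)

theorem toeplitzDet_dnMoment_succ {k : ℝ} (hk0 : 0 < k) (hk1 : k < 1) (w : ℝ) (n : ℕ) :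
    toeplitzDet (dnMoment k w) (n + 1) =
      shiftedMoment (dnMoment k w) (szegoPoly (dnReflection k w) n) n *
        toeplitzDet (dnMoment k w) n :=
  toeplitzDet_succ_eq (szegoPoly_natDegree_le_and_coeff _ n).1
    (szegoPoly_natDegree_le_and_coeff _ n).2
    fun _ hj => shiftedMoment_szegoPoly_eq_zero hk0 hk1 w hj

theorem toeplitzDet_dnMoment_pos {k w : ℝ} (hk0 : 0 < k) (hk1 : k < 1)
    (hw : ∀ M N : ℤ, N ≠ 0 → w ≠ 2 * ellipticK k * M / N) (n : ℕ) :
    0 < toeplitzDet (dnMoment k w) n := by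
  induction n with
  | zero => simp [toeplitzDet]
  | succ n ih =>
    rw [toeplitzDet_dnMoment_succ hk0 hk1]
    exact mul_pos (shiftedMoment_szegoPoly_self_pos hk0 hk1 hw n) ih

theorem dnPoly_eq_szegoPoly {k w : ℝ} (hk0 : 0 < k) (hk1 : k < 1)
    (hw : ∀ M N : ℤ, N ≠ 0 → w ≠ 2 * ellipticK k * M / N) (n : ℕ) :
    dnPoly k w n = szegoPoly (dnReflection k w) n :=
  circlePoly_eq (toeplitzDet_dnMoment_pos hk0 hk1 hw n).ne'
    (szegoPoly_natDegree_le_and_coeff _ n).1 (szegoPoly_natDegree_le_and_coeff _ n).2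
    fun _ hj => shiftedMoment_szegoPoly_eq_zero hk0 hk1 w hj

theorem circleNorm_dnMoment {k w : ℝ} (hk0 : 0 < k) (hk1 : k < 1)
    (hw : ∀ M N : ℤ, N ≠ 0 → w ≠ 2 * ellipticK k * M / N) (n : ℕ) : circleNorm (dnMoment k w) n =
    shiftedMoment (dnMoment k w) (szegoPoly (dnReflection k w) n) n := by
  rw [circleNorm, toeplitzDet_dnMoment_succ hk0 hk1,
    mul_div_cancel_right₀ _ (toeplitzDet_dnMoment_pos hk0 hk1 hw n).ne']

theorem reflectionParam_dnPoly {k w : ℝ} (hk0 : 0 < k) (hk1 : k < 1)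
    (hw : ∀ M N : ℤ, N ≠ 0 → w ≠ 2 * ellipticK k * M / N) (n : ℕ) :
    reflectionParam (dnPoly k w) n = dnReflection k w n := by
  rw [reflectionParam, dnPoly_eq_szegoPoly hk0 hk1 hw, ← coeff_zero_eq_eval_zero,
    szegoPoly_coeff_zero, neg_neg]

theorem momentFunctional_dnPoly_of_le {k w : ℝ} (hk0 : 0 < k) (hk1 : k < 1)
    (hw : ∀ M N : ℤ, N ≠ 0 → w ≠ 2 * ellipticK k * M / N) {n m : ℕ} (hmn : m ≤ n) :
    momentFunctional (dnMoment k w)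
      (toLaurent (dnPoly k w n) * LaurentPolynomial.invert (toLaurent (dnPoly k w m))) =
        if n = m then circleNorm (dnMoment k w) n else 0 := by
  have hd := szegoPoly_natDegree_le_and_coeff (dnReflection k w)
  rw [dnPoly_eq_szegoPoly hk0 hk1 hw, dnPoly_eq_szegoPoly hk0 hk1 hw,
    -- Since `m ≤ n`, every term below the leading one of the second polynomial meets a vanishing
    -- moment.
    momentFunctional_mul_invert _ (hd m).1, Finset.sum_range_succ,
    Finset.sum_eq_zero fun i hi => by
      rw [shiftedMoment_szegoPoly_eq_zero hk0 hk1 w (by simp at hi; lia), mul_zero],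
    (hd m).2, zero_add, one_mul]
  split_ifs with h
  · rw [h, circleNorm_dnMoment hk0 hk1 hw]
  · exact shiftedMoment_szegoPoly_eq_zero hk0 hk1 w (by lia)

theorem momentFunctional_dnPoly {k w : ℝ} (hk0 : 0 < k) (hk1 : k < 1)
    (hw : ∀ M N : ℤ, N ≠ 0 → w ≠ 2 * ellipticK k * M / N) (n m : ℕ) :
    momentFunctional (dnMoment k w)
      (toLaurent (dnPoly k w n) * LaurentPolynomial.invert (toLaurent (dnPoly k w m))) =
        if n = m then circleNorm (dnMoment k w) n else 0 := by
  rcases le_total m n with h | h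
  · exact momentFunctional_dnPoly_of_le hk0 hk1 hw h
  · rw [momentFunctional_mul_invert_comm (dnMoment_neg hk0 hk1 w),
      momentFunctional_dnPoly_of_le hk0 hk1 hw h]
    rcases eq_or_ne n m with rfl | hne
    · rfl
    · rw [if_neg hne, if_neg hne.symm]

/-! ### Elliptic binomial coefficients and the explicit polynomials. -/

theorem ellipticBinom_zero (k w : ℝ) (n : ℕ) : ellipticBinom k w n 0 = 1 := by simp [ellipticBinom]

theorem ellipticBinom_succ_mul {k w : ℝ} (hk0 : 0 < k) (hk1 : k < 1)
    (hw : ∀ M N : ℤ, N ≠ 0 → w ≠ 2 * ellipticK k * M / N) {n s : ℕ} (hs : s + 1 ≤ n) :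
    ellipticBinom k w n (s + 1) * jacobiSn k (w * (s + 1)) =
      ellipticBinom k w n s * jacobiSn k (w * (n - s)) := by
  rw [ellipticBinom, ellipticBinom, if_pos hs, if_pos (by lia), Finset.prod_range_succ, mul_assoc,
    div_mul_cancel₀ _ (jacobiSn_mul_nat_succ_ne_zero hk0 hk1 hw s)]

theorem ellipticBinom_succ_left_mul {k w : ℝ} (hk0 : 0 < k) (hk1 : k < 1)
    (hw : ∀ M N : ℤ, N ≠ 0 → w ≠ 2 * ellipticK k * M / N) {n s : ℕ} (hs : s ≤ n) :
    ellipticBinom k w (n + 1) s * jacobiSn k (w * (n + 1 - s)) =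
      ellipticBinom k w n s * jacobiSn k (w * (n + 1)) := by
  induction s with
  | zero => simp [ellipticBinom]
  | succ s ih =>
    have h1 := ellipticBinom_succ_mul hk0 hk1 hw hs
    have h2 := ellipticBinom_succ_mul hk0 hk1 hw (n := n + 1) (s := s) (by lia)
    have h3 := ih (by lia)
    have hne := jacobiSn_mul_nat_succ_ne_zero hk0 hk1 hw s
    refine mul_right_cancel₀ hne ?_
    rw [show w * ((n : ℝ) + 1 - (s + 1 : ℕ)) = w * (n - s) by push_cast; ring]
    push_cast at h2
    linear_combination jacobiSn k (w * (n - s)) * h2 + jacobiSn k (w * (n - s)) * h3 -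
      jacobiSn k (w * (n + 1)) * h1

theorem ellipticBinom_self {k w : ℝ} (hk0 : 0 < k) (hk1 : k < 1)
    (hw : ∀ M N : ℤ, N ≠ 0 → w ≠ 2 * ellipticK k * M / N) (n : ℕ) : ellipticBinom k w n n = 1 := by
  induction n with
  | zero => simp [ellipticBinom]
  | succ n ih =>
    have h1 := ellipticBinom_succ_mul hk0 hk1 hw (n := n + 1) (s := n) le_rfl
    have h2 := ellipticBinom_succ_left_mul hk0 hk1 hw (le_refl n)
    rw [ih] at h2
    push_cast at h1
    have hne := jacobiSn_mul_nat_succ_ne_zero hk0 hk1 hw n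
    refine mul_right_cancel₀ hne ?_
    linear_combination h1 + h2

theorem ellipticBinom_symm {k w : ℝ} (hk0 : 0 < k) (hk1 : k < 1)
    (hw : ∀ M N : ℤ, N ≠ 0 → w ≠ 2 * ellipticK k * M / N) {n s : ℕ} (hs : s ≤ n) :
    ellipticBinom k w n (n - s) = ellipticBinom k w n s := by
  induction s with
  | zero => simpa [ellipticBinom] using ellipticBinom_self hk0 hk1 hw n
  | succ s ih =>
    have h1 := ellipticBinom_succ_mul hk0 hk1 hw hs
    have h2 := ellipticBinom_succ_mul hk0 hk1 hw (n := n) (s := n - (s + 1)) (by lia)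
    rw [show n - (s + 1) + 1 = n - s by lia, ih (by lia), Nat.cast_sub hs,
      show w * ((n : ℝ) - (s + 1 : ℕ) + 1) = w * (n - s) by push_cast; ring,
      show w * ((n : ℝ) - (n - (s + 1 : ℕ))) = w * (s + 1) by push_cast; ring] at h2
    exact mul_right_cancel₀ (jacobiSn_mul_nat_succ_ne_zero hk0 hk1 hw s) (h2.symm.trans h1.symm)

theorem szegoPoly_dnReflection_coeff {k w : ℝ} (hk0 : 0 < k) (hk1 : k < 1)
    (hw : ∀ M N : ℤ, N ≠ 0 → w ≠ 2 * ellipticK k * M / N) (n : ℕ) : ∀ s : ℕ, s ≤ n →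
    (szegoPoly (dnReflection k w) n).coeff s =
      (if Even n then (-1) ^ s * jacobiCn k (w * (n - s))
        else (-1) ^ (s + 1) * jacobiDn k (w * (n - s))) * ellipticBinom k w n s := by
  induction n with
  | zero =>
    rintro s hs
    obtain rfl : s = 0 := by lia
    simp [szegoPoly, ellipticBinom, jacobiCn_zero hk0 hk1]
  | succ n ih =>
    intro s hs
    rcases s with _ | s
    · rw [szegoPoly_coeff_zero, dnReflection]
      simp only [Nat.even_add_one, ellipticBinom_zero]
      split_ifs <;> simp
    rcases hs.eq_or_lt with heq | hlt
    · rw [heq, (szegoPoly_natDegree_le_and_coeff _ (n + 1)).2, ellipticBinom_self hk0 hk1 hw]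
      split_ifs with h
      · rw [h.neg_one_pow]
        simp [jacobiCn_zero hk0 hk1]
      · rw [pow_succ, (Nat.not_even_iff_odd.1 h).neg_one_pow]
        simp [jacobiDn_zero hk0 hk1]
    have hsn : s + 1 ≤ n := by lia
    rw [szegoPoly_coeff_succ _ hsn, ih s (by lia), ih (n - (s + 1)) (by lia),
      ellipticBinom_symm hk0 hk1 hw hsn, Nat.cast_sub hsn]
    have hne : jacobiSn k (w * (n - s)) ≠ 0 := by
      have := jacobiSn_mul_int_ne_zero hk0 hk1 hw (N := (n : ℤ) - s) (by lia)
      simpa using this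
    have h1 := ellipticBinom_succ_mul hk0 hk1 hw hsn
    have h2 := ellipticBinom_succ_left_mul hk0 hk1 hw hsn
    -- After multiplication by `sn(w(n-s))`, relations `h1` and `h2` express all three binomials
    -- through `E^n_{s+1}`; what remains is the Pascal-type identity with `u = w(s+1)`, `v =
    -- w(n-s)`.
    refine mul_right_cancel₀ hne ?_
    have e1 : w * ((n : ℝ) + 1) = w * (s + 1) + w * (n - s) := by ring
    have e2 : w * ((n : ℝ) - (n - (s + 1 : ℕ))) = w * (s + 1) := by push_cast; ring
    have e3 : w * (((n + 1 : ℕ) : ℝ) - (s + 1 : ℕ)) = w * (n - s) := by push_cast; ring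
    rw [show w * ((n : ℝ) + 1 - (s + 1 : ℕ)) = w * (n - s) by push_cast; ring, e1] at h2
    rw [e2, e3, dnReflection, e1]
    have hsgn : (-1 : ℝ) ^ n = (-1) ^ (n - (s + 1)) * (-1) ^ s * (-1) := by
      rw [mul_assoc, ← pow_succ, ← pow_add]
      congr 1
      lia
    have hss : ((-1 : ℝ) ^ s) ^ 2 = 1 := by rw [← pow_mul, mul_comm, pow_mul]; simp
    by_cases hn : Even n
    · have hn' : ¬Even (n + 1) := by simpa [Nat.even_add_one] using hn
      rw [if_pos hn, if_pos hn, if_pos hn, if_neg hn']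
      rw [hn.neg_one_pow] at hsgn
      obtain hr : (-1 : ℝ) ^ (n - (s + 1)) = -(-1) ^ s := by
        linear_combination (-1 : ℝ) ^ s * hsgn - (-1 : ℝ) ^ (n - (s + 1)) * hss
      rw [hr, pow_succ, pow_succ]
      linear_combination (-(-1 : ℝ) ^ s) * jacobiCn k (w * (n - s)) * h1
        - (-1 : ℝ) ^ s * jacobiDn k (w * (n - s)) * h2
        - (-1 : ℝ) ^ s * ellipticBinom k w n (s + 1) *
          jacobiDn_mul_jacobiSn_add hk0 hk1 (w * (s + 1)) (w * (n - s))
    · have hn' : Even (n + 1) := Nat.even_add_one.2 hn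
      rw [if_neg hn, if_neg hn, if_neg hn, if_pos hn']
      rw [(Nat.not_even_iff_odd.1 hn).neg_one_pow] at hsgn
      obtain hr : (-1 : ℝ) ^ (n - (s + 1)) = (-1) ^ s := by
        linear_combination (-1 : ℝ) ^ s * hsgn - (-1 : ℝ) ^ (n - (s + 1)) * hss
      rw [pow_succ _ (n - (s + 1)), hr, pow_succ]
      linear_combination (-1 : ℝ) ^ s * jacobiCn k (w * (n - s)) * h2
        + (-1 : ℝ) ^ s * jacobiDn k (w * (n - s)) * h1
        + (-1 : ℝ) ^ s * ellipticBinom k w n (s + 1) *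
          jacobiCn_mul_jacobiSn_add hk0 hk1 (w * (s + 1)) (w * (n - s))

theorem dnPoly_coeff {k w : ℝ} (hk0 : 0 < k) (hk1 : k < 1)
    (hw : ∀ M N : ℤ, N ≠ 0 → w ≠ 2 * ellipticK k * M / N) (n s : ℕ) : (dnPoly k w n).coeff s =
    (if Even n then (-1) ^ s * jacobiCn k (w * (n - s))
      else (-1) ^ (s + 1) * jacobiDn k (w * (n - s))) * ellipticBinom k w n s := by
  rw [dnPoly_eq_szegoPoly hk0 hk1 hw]
  rcases le_or_gt s n with hs | hs
  · exact szegoPoly_dnReflection_coeff hk0 hk1 hw n s hs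
  · rw [coeff_eq_zero_of_natDegree_lt
      ((szegoPoly_natDegree_le_and_coeff _ n).1.trans_lt hs), ellipticBinom, if_neg hs.not_ge,
      mul_zero]

/-! ### Fourier coefficients of `dn` by a contour shift in real form. -/

/-- If `∂P/∂y = -∂Q/∂x` and `Q` takes equal values on both vertical sides, the integral of `P` over a
horizontal segment does not depend on its height. -/
theorem integral_eq_of_deriv_eq_neg_deriv {P Q R : ℝ → ℝ → ℝ} {a b Y : ℝ}
    (hP : ∀ x, ∀ y ∈ Set.uIcc 0 Y, HasDerivAt (fun y => P x y) (R x y) y)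
    (hQ : ∀ x, ∀ y ∈ Set.uIcc 0 Y, HasDerivAt (fun x => Q x y) (-R x y) x)
    (hR : ContinuousOn (Function.uncurry R) (Set.univ ×ˢ Set.uIcc 0 Y))
    (hab : ∀ y ∈ Set.uIcc 0 Y, Q a y = Q b y)
    (hPY : Continuous fun x => P x Y) (hP0 : Continuous fun x => P x 0) :
    ∫ x in a..b, P x Y = ∫ x in a..b, P x 0 := by
  have hRy : ∀ x, ContinuousOn (fun y => R x y) (Set.uIcc 0 Y) := fun x =>
    hR.comp (f := fun y => (x, y)) (by fun_prop) fun y hy => ⟨trivial, hy⟩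
  have hRx : ∀ y ∈ Set.uIcc 0 Y, Continuous (fun x => R x y) := fun y hy =>
    hR.comp_continuous (f := fun x => (x, y)) (by fun_prop) fun x => ⟨trivial, hy⟩
  rw [← sub_eq_zero, ← intervalIntegral.integral_sub (hPY.intervalIntegrable _ _)
    (hP0.intervalIntegrable _ _)]
  have h1 : ∀ x, P x Y - P x 0 = ∫ y in (0 : ℝ)..Y, R x y := fun x =>
    (intervalIntegral.integral_eq_sub_of_hasDerivAt (hP x) (hRy x).intervalIntegrable).symm
  simp only [h1]
  -- After Fubini the inner integral over `x` is the difference of `Q` between the vertical sides,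
  -- hence zero.
  rw [MeasureTheory.intervalIntegral_intervalIntegral_swap]
  · refine (intervalIntegral.integral_congr (g := fun _ => 0) fun y hy => ?_).trans (by simp)
    have h2 := intervalIntegral.integral_eq_sub_of_hasDerivAt (a := a) (b := b)
      (fun x _ => hQ x y hy) (hRx y hy).neg.continuousOn.intervalIntegrable
    rw [hab y hy, sub_self, intervalIntegral.integral_neg, neg_eq_zero] at h2
    exact h2
  · refine MeasureTheory.IntegrableOn.mono_set (t := Set.uIcc a b ×ˢ Set.uIcc 0 Y) ?_
      (Set.prod_mono Set.uIoc_subset_uIcc Set.uIoc_subset_uIcc)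
    exact (hR.mono (Set.prod_mono (Set.subset_univ _) subset_rfl)).integrableOn_compact
      (isCompact_uIcc.prod isCompact_uIcc)

/-- The complementary modulus. -/
noncomputable def complModulus (k : ℝ) : ℝ := Real.sqrt (1 - k ^ 2)

theorem complModulus_sq {k : ℝ} (hk0 : 0 < k) (hk1 : k < 1) : complModulus k ^ 2 = 1 - k ^ 2 :=
  Real.sq_sqrt (by nlinarith)

theorem complModulus_pos {k : ℝ} (hk0 : 0 < k) (hk1 : k < 1) : 0 < complModulus k :=
  Real.sqrt_pos.2 (by nlinarith)

theorem complModulus_lt_one {k : ℝ} (hk0 : 0 < k) : complModulus k < 1 := by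
  rw [complModulus, Real.sqrt_lt' one_pos]
  nlinarith

theorem continuous_jacobiSn {k : ℝ} (hk0 : 0 < k) (hk1 : k < 1) : Continuous (jacobiSn k) :=
  Real.continuous_sin.comp (continuous_jacobiAm hk0 hk1)

theorem continuous_jacobiCn {k : ℝ} (hk0 : 0 < k) (hk1 : k < 1) : Continuous (jacobiCn k) :=
  Real.continuous_cos.comp (continuous_jacobiAm hk0 hk1)

theorem continuous_jacobiDn {k : ℝ} (hk0 : 0 < k) (hk1 : k < 1) : Continuous (jacobiDn k) :=
  Real.continuous_sqrt.comp (continuous_const.sub (continuous_const.mul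
    ((continuous_jacobiSn hk0 hk1).pow 2)))

theorem jacobiDn_le_one (k u : ℝ) : jacobiDn k u ≤ 1 := by
  rw [jacobiDn, Real.sqrt_le_one]
  nlinarith [mul_nonneg (sq_nonneg k) (sq_nonneg (jacobiSn k u))]

theorem jacobiCn_pos {k : ℝ} (hk0 : 0 < k) (hk1 : k < 1) {u : ℝ} (h0 : 0 ≤ u)
    (h1 : u < ellipticK k) : 0 < jacobiCn k u := by
  have h2 := (jacobiAm_strictMono hk0 hk1).monotone h0
  have h3 := jacobiAm_strictMono hk0 hk1 h1
  rw [jacobiAm_zero hk0 hk1] at h2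
  rw [jacobiAm_ellipticK hk0 hk1] at h3
  exact Real.cos_pos_of_mem_Ioo ⟨by linarith [Real.pi_pos], h3⟩

/-- The denominator of the continuation of `dn` to the complex plane. -/
noncomputable def dnDenom (k x y : ℝ) : ℝ :=
  jacobiCn (complModulus k) y ^ 2 + k ^ 2 * jacobiSn k x ^ 2 * jacobiSn (complModulus k) y ^ 2

/-- The real part of `dn (x + i y)`. -/
noncomputable def dnRe (k x y : ℝ) : ℝ :=
  jacobiDn k x * jacobiCn (complModulus k) y * jacobiDn (complModulus k) y / dnDenom k x y

/-- The imaginary part of `dn (x + i y)`. -/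
noncomputable def dnIm (k x y : ℝ) : ℝ :=
  -(k ^ 2 * jacobiSn k x * jacobiCn k x * jacobiSn (complModulus k) y) / dnDenom k x y

/-- The derivative of `dnRe` in the horizontal direction. -/
noncomputable def dnRe' (k x y : ℝ) : ℝ :=
  -(jacobiCn (complModulus k) y * jacobiDn (complModulus k) y * k ^ 2 * jacobiSn k x *
    jacobiCn k x * (dnDenom k x y + 2 * jacobiDn k x ^ 2 * jacobiSn (complModulus k) y ^ 2)) /
      dnDenom k x y ^ 2

/-- The derivative of `dnIm` in the horizontal direction. -/
noncomputable def dnIm' (k x y : ℝ) : ℝ :=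
  -(k ^ 2 * jacobiSn (complModulus k) y * jacobiDn k x *
    ((jacobiCn k x ^ 2 - jacobiSn k x ^ 2) * dnDenom k x y -
      2 * k ^ 2 * jacobiSn k x ^ 2 * jacobiCn k x ^ 2 * jacobiSn (complModulus k) y ^ 2)) /
      dnDenom k x y ^ 2

theorem dnDenom_pos {k : ℝ} (hk0 : 0 < k) (hk1 : k < 1) (x : ℝ) {y : ℝ} (h0 : 0 ≤ y)
    (h1 : y < ellipticK (complModulus k)) : 0 < dnDenom k x y := by
  have := jacobiCn_pos (complModulus_pos hk0 hk1) (complModulus_lt_one hk0) h0 h1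
  unfold dnDenom
  positivity

theorem hasDerivAt_dnDenom_left {k : ℝ} (hk0 : 0 < k) (hk1 : k < 1) (x y : ℝ) :
    HasDerivAt (fun x => dnDenom k x y) (2 * k ^ 2 * jacobiSn k x * jacobiCn k x * jacobiDn k x *
      jacobiSn (complModulus k) y ^ 2) x := by
  refine (((((hasDerivAt_jacobiSn hk0 hk1 x).pow 2).const_mul (k ^ 2)).mul_const
    (jacobiSn (complModulus k) y ^ 2)).const_add
      (jacobiCn (complModulus k) y ^ 2)).congr_deriv ?_
  push_cast
  ring

theorem hasDerivAt_dnDenom_right {k : ℝ} (hk0 : 0 < k) (hk1 : k < 1) (x y : ℝ) :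
    HasDerivAt (fun y => dnDenom k x y) (-2 * jacobiSn (complModulus k) y *
      jacobiCn (complModulus k) y * jacobiDn (complModulus k) y * jacobiDn k x ^ 2) y := by
  have hk := complModulus_pos hk0 hk1
  have hk' := complModulus_lt_one hk0
  refine (((hasDerivAt_jacobiCn hk hk' y).pow 2).add
    (((hasDerivAt_jacobiSn hk hk' y).pow 2).const_mul (k ^ 2 * jacobiSn k x ^ 2))).congr_deriv ?_
  rw [jacobiDn_sq hk0 hk1]
  push_cast
  ring

theorem hasDerivAt_dnRe_left {k : ℝ} (hk0 : 0 < k) (hk1 : k < 1) (x : ℝ) {y : ℝ} (h0 : 0 ≤ y)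
    (h1 : y < ellipticK (complModulus k)) :
    HasDerivAt (fun x => dnRe k x y) (dnRe' k x y) x := by
  have hD := (dnDenom_pos hk0 hk1 x h0 h1).ne'
  refine ((((hasDerivAt_jacobiDn hk0 hk1 x).mul_const _).mul_const _).div
    (hasDerivAt_dnDenom_left hk0 hk1 x y) hD).congr_deriv ?_
  rw [dnRe']
  congr 1
  ring

theorem hasDerivAt_dnIm_left {k : ℝ} (hk0 : 0 < k) (hk1 : k < 1) (x : ℝ) {y : ℝ} (h0 : 0 ≤ y)
    (h1 : y < ellipticK (complModulus k)) :
    HasDerivAt (fun x => dnIm k x y) (dnIm' k x y) x := by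
  have hD := (dnDenom_pos hk0 hk1 x h0 h1).ne'
  refine ((((((hasDerivAt_jacobiSn hk0 hk1 x).const_mul (k ^ 2)).mul
    (hasDerivAt_jacobiCn hk0 hk1 x)).mul_const (jacobiSn (complModulus k) y)).neg).div
    (hasDerivAt_dnDenom_left hk0 hk1 x y) hD).congr_deriv ?_
  rw [dnIm']
  congr 1
  simp only [Pi.mul_apply, Pi.neg_apply]
  ring

/-- With the neighbouring derivative lemmas this gives the Cauchy–Riemann equations for `dnRe + i
dnIm`, so no complex `dn` has to be constructed. The quadratic relations for both moduli and `k² +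
k'² = 1` enter here. -/
theorem hasDerivAt_dnRe_right {k : ℝ} (hk0 : 0 < k) (hk1 : k < 1) (x : ℝ) {y : ℝ} (h0 : 0 ≤ y)
    (h1 : y < ellipticK (complModulus k)) :
    HasDerivAt (fun y => dnRe k x y) (-dnIm' k x y) y := by
  have hD := (dnDenom_pos hk0 hk1 x h0 h1).ne'
  have hk := complModulus_pos hk0 hk1
  have hk' := complModulus_lt_one hk0
  refine ((((hasDerivAt_jacobiCn hk hk' y).const_mul (jacobiDn k x)).mul
    (hasDerivAt_jacobiDn hk hk' y)).div
    (hasDerivAt_dnDenom_right hk0 hk1 x y) hD).congr_deriv ?_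
  rw [dnIm', neg_div, neg_neg]
  congr 1
  have e1 := jacobiSn_sq_add_jacobiCn_sq k x
  have e2 := jacobiSn_sq_add_jacobiCn_sq (complModulus k) y
  have e3 := jacobiDn_sq hk0 hk1 x
  have e4 := jacobiDn_sq hk hk' y
  rw [complModulus_sq hk0 hk1] at e4 ⊢
  rw [dnDenom]
  simp only [Pi.mul_apply]
  clear hD
  grind

theorem hasDerivAt_dnIm_right {k : ℝ} (hk0 : 0 < k) (hk1 : k < 1) (x : ℝ) {y : ℝ} (h0 : 0 ≤ y)
    (h1 : y < ellipticK (complModulus k)) :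
    HasDerivAt (fun y => dnIm k x y) (dnRe' k x y) y := by
  have hD := (dnDenom_pos hk0 hk1 x h0 h1).ne'
  have hk := complModulus_pos hk0 hk1
  have hk' := complModulus_lt_one hk0
  refine ((((hasDerivAt_jacobiSn hk hk' y).const_mul
    (k ^ 2 * jacobiSn k x * jacobiCn k x)).neg).div
    (hasDerivAt_dnDenom_right hk0 hk1 x y) hD).congr_deriv ?_
  rw [dnRe']
  congr 1
  simp only [Pi.neg_apply]
  ring

/-- The real part of `dn z · exp (-i l z)` at `z = x + i y`. -/
noncomputable def dnExpRe (k l x y : ℝ) : ℝ :=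
  Real.exp (l * y) * (dnRe k x y * Real.cos (l * x) + dnIm k x y * Real.sin (l * x))

theorem continuous_dnRe_left {k : ℝ} (hk0 : 0 < k) (hk1 : k < 1) {y : ℝ} (h0 : 0 ≤ y)
    (h1 : y < ellipticK (complModulus k)) : Continuous fun x => dnRe k x y :=
  continuous_iff_continuousAt.2 fun x => (hasDerivAt_dnRe_left hk0 hk1 x h0 h1).continuousAt

theorem continuous_dnIm_left {k : ℝ} (hk0 : 0 < k) (hk1 : k < 1) {y : ℝ} (h0 : 0 ≤ y)
    (h1 : y < ellipticK (complModulus k)) : Continuous fun x => dnIm k x y :=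
  continuous_iff_continuousAt.2 fun x => (hasDerivAt_dnIm_left hk0 hk1 x h0 h1).continuousAt

theorem dnRe_zero {k : ℝ} (hk0 : 0 < k) (hk1 : k < 1) (x : ℝ) : dnRe k x 0 = jacobiDn k x := by
  have hk := complModulus_pos hk0 hk1
  have hk' := complModulus_lt_one hk0
  simp [dnRe, dnDenom, jacobiSn_zero hk hk', jacobiCn_zero hk hk', jacobiDn_zero hk hk']

theorem dnIm_zero {k : ℝ} (hk0 : 0 < k) (hk1 : k < 1) (x : ℝ) : dnIm k x 0 = 0 := by
  simp [dnIm, jacobiSn_zero (complModulus_pos hk0 hk1) (complModulus_lt_one hk0)]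

theorem jacobiCn_ellipticK {k : ℝ} (hk0 : 0 < k) (hk1 : k < 1) : jacobiCn k (ellipticK k) = 0 := by
  rw [jacobiCn, jacobiAm_ellipticK hk0 hk1, Real.cos_pi_div_two]

/-- Cauchy's theorem on a rectangle below the pole. The flux `Q` is the imaginary part of `dn z ·
e^{-ilz}`; on the sides `x = ±K` it vanishes because `cn K = 0` kills `dnIm` and `hl` kills the
sine. -/
theorem integral_dnExpRe {k l : ℝ} (hk0 : 0 < k) (hk1 : k < 1) (hl : Real.sin (l * ellipticK k) = 0)
    {Y : ℝ} (h0 : 0 ≤ Y) (h1 : Y < ellipticK (complModulus k)) :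
    ∫ x in -ellipticK k..ellipticK k, dnExpRe k l x Y =
      ∫ x in -ellipticK k..ellipticK k, jacobiDn k x * Real.cos (l * x) := by
  have hk := complModulus_pos hk0 hk1
  have hk' := complModulus_lt_one hk0
  have hcont : ∀ y, 0 ≤ y → y < ellipticK (complModulus k) →
      Continuous fun x => dnExpRe k l x y := fun y hy0 hy1 => by
    have := continuous_dnRe_left hk0 hk1 hy0 hy1
    have := continuous_dnIm_left hk0 hk1 hy0 hy1
    unfold dnExpRe
    fun_prop
  have hmem : ∀ y ∈ Set.uIcc 0 Y, 0 ≤ y ∧ y < ellipticK (complModulus k) := fun y hy => by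
    rw [Set.uIcc_of_le h0] at hy
    exact ⟨hy.1, hy.2.trans_lt h1⟩
  rw [integral_eq_of_deriv_eq_neg_deriv (P := dnExpRe k l)
    (Q := fun x y => Real.exp (l * y) *
      (dnIm k x y * Real.cos (l * x) - dnRe k x y * Real.sin (l * x)))
    (R := fun x y => -(Real.exp (l * y) * (dnIm' k x y * Real.cos (l * x) -
      l * dnIm k x y * Real.sin (l * x) - dnRe' k x y * Real.sin (l * x) -
        l * dnRe k x y * Real.cos (l * x)))) ?_ ?_ ?_ ?_ (hcont Y h0 h1)
        (hcont 0 le_rfl (h0.trans_lt h1))]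
  · refine intervalIntegral.integral_congr fun x _ => ?_
    simp [dnExpRe, dnRe_zero hk0 hk1, dnIm_zero hk0 hk1]
  · intro x y hy
    obtain ⟨hy0, hy1⟩ := hmem y hy
    refine ((((hasDerivAt_id y).const_mul l).exp).mul
      (((hasDerivAt_dnRe_right hk0 hk1 x hy0 hy1).mul_const (Real.cos (l * x))).add
        ((hasDerivAt_dnIm_right hk0 hk1 x hy0 hy1).mul_const (Real.sin (l * x))))).congr_deriv ?_
    simp only [id, Pi.add_apply]
    ring
  · intro x y hy
    obtain ⟨hy0, hy1⟩ := hmem y hy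
    refine (((hasDerivAt_dnIm_left hk0 hk1 x hy0 hy1).mul
      ((hasDerivAt_id x).const_mul l).cos).sub ((hasDerivAt_dnRe_left hk0 hk1 x hy0 hy1).mul
        ((hasDerivAt_id x).const_mul l).sin) |>.const_mul (Real.exp (l * y))).congr_deriv ?_
    simp only [id]
    ring
  · have hs1 := continuous_jacobiSn hk0 hk1
    have hc1 := continuous_jacobiCn hk0 hk1
    have hd1 := continuous_jacobiDn hk0 hk1
    have hs2 := continuous_jacobiSn hk hk'
    have hc2 := continuous_jacobiCn hk hk'
    have hd2 := continuous_jacobiDn hk hk'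
    have hne : ∀ z ∈ (Set.univ ×ˢ Set.uIcc 0 Y : Set (ℝ × ℝ)), dnDenom k z.1 z.2 ≠ 0 :=
      fun z hz => (dnDenom_pos hk0 hk1 _ (hmem _ hz.2).1 (hmem _ hz.2).2).ne'
    have hne2 : ∀ z ∈ (Set.univ ×ˢ Set.uIcc 0 Y : Set (ℝ × ℝ)), dnDenom k z.1 z.2 ^ 2 ≠ 0 :=
      fun z hz => pow_ne_zero 2 (hne z hz)
    have hD : Continuous fun z : ℝ × ℝ => dnDenom k z.1 z.2 := by unfold dnDenom; fun_prop
    have hU : ContinuousOn (fun z : ℝ × ℝ => dnRe k z.1 z.2) (Set.univ ×ˢ Set.uIcc 0 Y) :=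
      ContinuousOn.div (by fun_prop) hD.continuousOn hne
    have hV : ContinuousOn (fun z : ℝ × ℝ => dnIm k z.1 z.2) (Set.univ ×ˢ Set.uIcc 0 Y) :=
      ContinuousOn.div (by fun_prop) hD.continuousOn hne
    have hU' : ContinuousOn (fun z : ℝ × ℝ => dnRe' k z.1 z.2) (Set.univ ×ˢ Set.uIcc 0 Y) :=
      ContinuousOn.div (by fun_prop) (hD.pow 2).continuousOn hne2
    have hV' : ContinuousOn (fun z : ℝ × ℝ => dnIm' k z.1 z.2) (Set.univ ×ˢ Set.uIcc 0 Y) :=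
      ContinuousOn.div (by fun_prop) (hD.pow 2).continuousOn hne2
    unfold Function.uncurry
    fun_prop
  · intro y _
    simp [dnIm, jacobiCn_neg hk0 hk1, jacobiCn_ellipticK hk0 hk1, hl]

theorem integral_jacobiDn {k : ℝ} (hk0 : 0 < k) (hk1 : k < 1) :
    ∫ x in -ellipticK k..ellipticK k, jacobiDn k x = Real.pi := by
  rw [intervalIntegral.integral_eq_sub_of_hasDerivAt (fun x _ => hasDerivAt_jacobiAm hk0 hk1 x)
    ((continuous_jacobiDn hk0 hk1).intervalIntegrable _ _), jacobiAm_neg hk0 hk1,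
    jacobiAm_ellipticK hk0 hk1]
  ring

theorem integral_dnRe {k : ℝ} (hk0 : 0 < k) (hk1 : k < 1) {Y : ℝ} (h0 : 0 ≤ Y)
    (h1 : Y < ellipticK (complModulus k)) :
    ∫ x in -ellipticK k..ellipticK k, dnRe k x Y = Real.pi := by
  have h := integral_dnExpRe (l := 0) hk0 hk1 (by simp) h0 h1
  simpa [dnExpRe, integral_jacobiDn hk0 hk1] using h

/-- With `A`, `B` the cosine and sine integrals at height `Y`, the shifts for `l` and `-l` read
`e^{lY}(A + B) = J = e^{-lY}(A - B)`; eliminate `B`. -/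
theorem integral_dnRe_mul_cos {k l : ℝ} (hk0 : 0 < k) (hk1 : k < 1)
    (hl : Real.sin (l * ellipticK k) = 0) {Y : ℝ} (h0 : 0 ≤ Y)
    (h1 : Y < ellipticK (complModulus k)) :
    ∫ x in -ellipticK k..ellipticK k, dnRe k x Y * Real.cos (l * x) =
      (∫ x in -ellipticK k..ellipticK k, jacobiDn k x * Real.cos (l * x)) * Real.cosh (l * Y) := by
  have hU := continuous_dnRe_left hk0 hk1 h0 h1
  have hV := continuous_dnIm_left hk0 hk1 h0 h1
  have e1 := integral_dnExpRe hk0 hk1 hl h0 h1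
  have e2 := integral_dnExpRe (l := -l) hk0 hk1 (by simpa using hl) h0 h1
  simp only [dnExpRe, neg_mul, Real.cos_neg, Real.sin_neg, mul_neg, ← sub_eq_add_neg] at e1 e2
  rw [intervalIntegral.integral_const_mul] at e1 e2
  rw [intervalIntegral.integral_add (Continuous.intervalIntegrable (by fun_prop) _ _)
    (Continuous.intervalIntegrable (by fun_prop) _ _)] at e1
  rw [intervalIntegral.integral_sub (Continuous.intervalIntegrable (by fun_prop) _ _)
    (Continuous.intervalIntegrable (by fun_prop) _ _)] at e2
  have e3 : Real.exp (l * Y) * Real.exp (-(l * Y)) = 1 := by rw [← Real.exp_add]; simp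
  rw [Real.cosh_eq]
  set A := ∫ x in -ellipticK k..ellipticK k, dnRe k x Y * Real.cos (l * x)
  set B := ∫ x in -ellipticK k..ellipticK k, dnIm k x Y * Real.sin (l * x)
  linear_combination Real.exp (-(l * Y)) / 2 * e1 + Real.exp (l * Y) / 2 * e2 - A * e3

theorem abs_ellipticF_le {k : ℝ} (hk0 : 0 < k) (hk1 : k < 1) (φ : ℝ) :
    |ellipticF k φ| ≤ 1 / complModulus k * |φ| := by
  have h := Convex.norm_image_sub_le_of_norm_hasDerivWithin_le (f := ellipticF k) (s := Set.univ)
    (C := 1 / complModulus k) (x := 0) (y := φ)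
    (fun x _ => (hasDerivAt_ellipticF hk0 hk1 x).hasDerivWithinAt) (fun x _ => ?_)
    convex_univ trivial trivial
  · simpa [ellipticF_zero] using h
  · rw [Real.norm_of_nonneg (by positivity)]
    refine one_div_le_one_div_of_le (complModulus_pos hk0 hk1) (Real.sqrt_le_sqrt ?_)
    nlinarith [Real.sin_sq_le_one x, sq_nonneg k]

/-- Combines `F' ≤ 1/k'` with Jordan's inequality for the amplitude. It bounds `1 - cos(lx)` by a
multiple of `sn² x`, the quantity that tames the kernel near the pole. -/
theorem abs_le_mul_abs_jacobiSn {k : ℝ} (hk0 : 0 < k) (hk1 : k < 1) {x : ℝ}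
    (hx : x ∈ Set.Icc (-ellipticK k) (ellipticK k)) :
    |x| ≤ Real.pi / (2 * complModulus k) * |jacobiSn k x| := by
  have hm := (jacobiAm_strictMono hk0 hk1).monotone
  have h1 := hm hx.1
  have h2 := hm hx.2
  rw [jacobiAm_neg hk0 hk1, jacobiAm_ellipticK hk0 hk1] at h1
  rw [jacobiAm_ellipticK hk0 hk1] at h2
  have h3 := Real.mul_abs_le_abs_sin (abs_le.2 ⟨h1, h2⟩)
  have h4 := abs_ellipticF_le hk0 hk1 (jacobiAm k x)
  rw [ellipticF_jacobiAm hk0 hk1] at h4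
  have hk := complModulus_pos hk0 hk1
  have hpi := Real.pi_pos
  refine h4.trans ?_
  rw [jacobiSn, show Real.pi / (2 * complModulus k) * |Real.sin (jacobiAm k x)| =
    1 / complModulus k * (Real.pi / 2 * |Real.sin (jacobiAm k x)|) by field_simp]
  refine mul_le_mul_of_nonneg_left ?_ (by positivity)
  calc |jacobiAm k x| = Real.pi / 2 * (2 / Real.pi * |jacobiAm k x|) := by field_simp
    _ ≤ _ := by gcongr

theorem dnRe_nonneg {k : ℝ} (hk0 : 0 < k) (hk1 : k < 1) (x : ℝ) {Y : ℝ} (h0 : 0 ≤ Y)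
    (h1 : Y < ellipticK (complModulus k)) : 0 ≤ dnRe k x Y := by
  have hk := complModulus_pos hk0 hk1
  have hk' := complModulus_lt_one hk0
  exact div_nonneg (mul_nonneg (mul_nonneg (jacobiDn_pos hk0 hk1 x).le
    (jacobiCn_pos hk hk' h0 h1).le) (jacobiDn_pos hk hk' Y).le) (dnDenom_pos hk0 hk1 x h0 h1).le

/-- The factor on the left is at most the denominator of `dnRe`. The bound is uniform in `x` and
tends to `0` as `Y → K'`: away from `x = 0` the kernel dies out. -/
theorem dnRe_mul_jacobiSn_sq_le {k : ℝ} (hk0 : 0 < k) (hk1 : k < 1) (x : ℝ) {Y : ℝ} (h0 : 0 ≤ Y)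
    (h1 : Y < ellipticK (complModulus k)) :
    dnRe k x Y * (k ^ 2 * jacobiSn k x ^ 2 * jacobiSn (complModulus k) Y ^ 2) ≤
      jacobiCn (complModulus k) Y := by
  have hk := complModulus_pos hk0 hk1
  have hk' := complModulus_lt_one hk0
  have hC := jacobiCn_pos hk hk' h0 h1
  calc _ ≤ dnRe k x Y * dnDenom k x Y :=
        mul_le_mul_of_nonneg_left (le_add_of_nonneg_left (sq_nonneg _))
          (dnRe_nonneg hk0 hk1 x h0 h1)
    _ = jacobiDn k x * jacobiDn (complModulus k) Y * jacobiCn (complModulus k) Y := by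
        rw [dnRe, div_mul_cancel₀ _ (dnDenom_pos hk0 hk1 x h0 h1).ne']; ring
    _ ≤ 1 * jacobiCn (complModulus k) Y := by
        refine mul_le_mul_of_nonneg_right ?_ hC.le
        exact mul_le_one₀ (jacobiDn_le_one _ _) (jacobiDn_pos hk hk' Y).le (jacobiDn_le_one _ _)
    _ = _ := one_mul _

/-- The difference equals `∫ Re dn(x+iY) (1 - cos(lx)) dx`, since the kernel has mass `π`: an
approximate-identity estimate with explicit error. -/
theorem pi_sub_integral_mul_cosh_bounds {k l : ℝ} (hk0 : 0 < k) (hk1 : k < 1)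
    (hl : Real.sin (l * ellipticK k) = 0) {Y : ℝ} (h0 : 0 ≤ Y)
    (h1 : Y < ellipticK (complModulus k)) (hS : jacobiSn (complModulus k) Y ≠ 0) :
    0 ≤ Real.pi - (∫ x in -ellipticK k..ellipticK k, jacobiDn k x * Real.cos (l * x)) *
        Real.cosh (l * Y) ∧
      Real.pi - (∫ x in -ellipticK k..ellipticK k, jacobiDn k x * Real.cos (l * x)) *
        Real.cosh (l * Y) ≤ 2 * ellipticK k * (l ^ 2 / 2 * (Real.pi / (2 * complModulus k)) ^ 2 *
          (jacobiCn (complModulus k) Y / (k ^ 2 * jacobiSn (complModulus k) Y ^ 2))) := by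
  have hU := continuous_dnRe_left hk0 hk1 h0 h1
  have hK := ellipticK_pos hk0 hk1
  have h8 : Real.pi - (∫ x in -ellipticK k..ellipticK k, jacobiDn k x * Real.cos (l * x)) *
      Real.cosh (l * Y) =
        ∫ x in -ellipticK k..ellipticK k, (dnRe k x Y - dnRe k x Y * Real.cos (l * x)) := by
    rw [← integral_dnRe_mul_cos hk0 hk1 hl h0 h1, ← integral_dnRe hk0 hk1 h0 h1,
      ← intervalIntegral.integral_sub (Continuous.intervalIntegrable (by fun_prop) _ _)
      (Continuous.intervalIntegrable (by fun_prop) _ _)]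
  rw [h8]
  constructor
  · refine intervalIntegral.integral_nonneg (by linarith) fun x _ => ?_
    nlinarith [dnRe_nonneg hk0 hk1 x h0 h1, Real.cos_le_one (l * x)]
  · set B := l ^ 2 / 2 * (Real.pi / (2 * complModulus k)) ^ 2 *
          (jacobiCn (complModulus k) Y / (k ^ 2 * jacobiSn (complModulus k) Y ^ 2)) with hB
    have h2 : ∫ _x in -ellipticK k..ellipticK k, B = 2 * ellipticK k * B := by
      rw [intervalIntegral.integral_const, smul_eq_mul]
      ring
    rw [← h2]
    refine intervalIntegral.integral_mono_on (by linarith)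
      (Continuous.intervalIntegrable (by fun_prop) _ _)
      (Continuous.intervalIntegrable (by fun_prop) _ _) fun x hx => ?_
    have h3 : 1 - Real.cos (l * x) ≤
        l ^ 2 / 2 * (Real.pi / (2 * complModulus k)) ^ 2 * jacobiSn k x ^ 2 := by
      have h4 := Real.one_sub_sq_div_two_le_cos (x := l * x)
      have h5 := pow_le_pow_left₀ (abs_nonneg x) (abs_le_mul_abs_jacobiSn hk0 hk1 hx) 2
      rw [mul_pow, sq_abs, sq_abs] at h5
      nlinarith [mul_le_mul_of_nonneg_left h5 (sq_nonneg l)]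
    have h6 := dnRe_mul_jacobiSn_sq_le hk0 hk1 x h0 h1
    have h7 : dnRe k x Y * jacobiSn k x ^ 2 ≤
        jacobiCn (complModulus k) Y / (k ^ 2 * jacobiSn (complModulus k) Y ^ 2) := by
      rw [le_div_iff₀ (by positivity)]
      linarith
    calc dnRe k x Y - dnRe k x Y * Real.cos (l * x) = dnRe k x Y * (1 - Real.cos (l * x)) := by ring
      _ ≤ dnRe k x Y * (l ^ 2 / 2 * (Real.pi / (2 * complModulus k)) ^ 2 * jacobiSn k x ^ 2) :=
        mul_le_mul_of_nonneg_left h3 (dnRe_nonneg hk0 hk1 x h0 h1)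
      _ = l ^ 2 / 2 * (Real.pi / (2 * complModulus k)) ^ 2 * (dnRe k x Y * jacobiSn k x ^ 2) := by
        ring
      _ ≤ B := mul_le_mul_of_nonneg_left h7 (by positivity)

theorem integral_jacobiDn_mul_cos {k l : ℝ} (hk0 : 0 < k) (hk1 : k < 1)
    (hl : Real.sin (l * ellipticK k) = 0) :
    (∫ x in -ellipticK k..ellipticK k, jacobiDn k x * Real.cos (l * x)) *
      Real.cosh (l * ellipticK (complModulus k)) = Real.pi := by
  have hk := complModulus_pos hk0 hk1
  have hk' := complModulus_lt_one hk0
  set L := ellipticK (complModulus k) with hL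
  have hL0 : 0 < L := ellipticK_pos hk hk'
  set J := ∫ x in -ellipticK k..ellipticK k, jacobiDn k x * Real.cos (l * x)
  have hsL : jacobiSn (complModulus k) L = 1 := by
    rw [jacobiSn, hL, jacobiAm_ellipticK hk hk', Real.sin_pi_div_two]
  have hcL : jacobiCn (complModulus k) L = 0 := jacobiCn_ellipticK hk hk'
  have hs := (continuous_jacobiSn hk hk').continuousAt (x := L)
  have hc := (continuous_jacobiCn hk hk').continuousAt (x := L)
  have h1 : Filter.Tendsto (fun Y => Real.pi - J * Real.cosh (l * Y)) (nhdsWithin L (Set.Iio L))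
      (nhds (Real.pi - J * Real.cosh (l * L))) := by
    have : Continuous fun Y => Real.pi - J * Real.cosh (l * Y) := by fun_prop
    exact this.continuousAt.tendsto.mono_left nhdsWithin_le_nhds
  have h2 : Filter.Tendsto (fun Y => 2 * ellipticK k * (l ^ 2 / 2 *
      (Real.pi / (2 * complModulus k)) ^ 2 * (jacobiCn (complModulus k) Y /
        (k ^ 2 * jacobiSn (complModulus k) Y ^ 2)))) (nhdsWithin L (Set.Iio L)) (nhds 0) := by
    have h3 : ContinuousAt (fun Y => 2 * ellipticK k * (l ^ 2 / 2 *
      (Real.pi / (2 * complModulus k)) ^ 2 * (jacobiCn (complModulus k) Y /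
        (k ^ 2 * jacobiSn (complModulus k) Y ^ 2)))) L := by
      refine continuousAt_const.mul (continuousAt_const.mul
        (hc.div (continuousAt_const.mul (hs.pow 2)) ?_))
      rw [hsL]
      positivity
    have h4 := h3.tendsto
    rw [hcL] at h4
    simp only [zero_div, mul_zero] at h4
    exact h4.mono_left nhdsWithin_le_nhds
  have hev : ∀ᶠ Y in nhdsWithin L (Set.Iio L), 0 ≤ Y ∧ Y < L ∧ jacobiSn (complModulus k) Y ≠ 0 := by
    have h5 : ∀ᶠ Y in nhdsWithin L (Set.Iio L), 0 < Y :=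
      (eventually_gt_nhds hL0).filter_mono nhdsWithin_le_nhds
    have h6 : ∀ᶠ Y in nhdsWithin L (Set.Iio L), jacobiSn (complModulus k) Y ≠ 0 :=
      (hs.eventually_ne (by rw [hsL]; exact one_ne_zero)).filter_mono nhdsWithin_le_nhds
    filter_upwards [h5, h6, self_mem_nhdsWithin] with Y a b c using ⟨a.le, c, b⟩
  have h7 := squeeze_zero' (hev.mono fun Y h =>
    (pi_sub_integral_mul_cosh_bounds hk0 hk1 hl h.1 h.2.1 h.2.2).1) (hev.mono fun Y h =>
    (pi_sub_integral_mul_cosh_bounds hk0 hk1 hl h.1 h.2.1 h.2.2).2) h2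
  linarith [tendsto_nhds_unique h1 h7]

/-! ### Nome, weights and the Fourier series of `dn`. -/

theorem ellipticNome_pos (k : ℝ) : 0 < ellipticNome k := Real.exp_pos _

theorem ellipticNome_zpow_add (k : ℝ) (s : ℤ) : ellipticNome k ^ s + ellipticNome k ^ (-s) =
    2 * Real.cosh (Real.pi * s / ellipticK k * ellipticK (complModulus k)) := by
  rw [ellipticNome, ← Real.rpow_intCast, ← Real.rpow_intCast,
    ← Real.exp_mul, ← Real.exp_mul, Real.cosh_eq, ellipticK',
    ← complModulus]
  rw [add_comm]
  push_cast
  rw [show -Real.pi * ellipticK (complModulus k) / ellipticK k * -(s : ℝ) =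
    Real.pi * s / ellipticK k * ellipticK (complModulus k) by ring,
    show -Real.pi * ellipticK (complModulus k) / ellipticK k * (s : ℝ) =
    -(Real.pi * s / ellipticK k * ellipticK (complModulus k)) by ring]
  ring

theorem dnWeight_pos {k : ℝ} (hk0 : 0 < k) (hk1 : k < 1) (s : ℤ) : 0 < dnWeight k s := by
  have := ellipticK_pos hk0 hk1
  have := ellipticNome_pos k
  have := Real.pi_pos
  unfold dnWeight
  positivity

theorem ellipticNome_lt_one {k : ℝ} (hk0 : 0 < k) (hk1 : k < 1) : ellipticNome k < 1 := by
  have h1 := ellipticK_pos hk0 hk1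
  have h2 := ellipticK_pos (complModulus_pos hk0 hk1) (complModulus_lt_one hk0)
  rw [ellipticNome, Real.exp_lt_one_iff, neg_mul, neg_div, neg_lt_zero]
  have := Real.pi_pos
  exact div_pos (mul_pos this h2) h1

theorem dnWeight_neg (k : ℝ) (s : ℤ) : dnWeight k (-s) = dnWeight k s := by
  rw [dnWeight, dnWeight, neg_neg, add_comm]

theorem summable_dnWeight {k : ℝ} (hk0 : 0 < k) (hk1 : k < 1) : Summable (dnWeight k) := by
  have hq0 := ellipticNome_pos k
  have hK := ellipticK_pos hk0 hk1
  have hnat : Summable fun n : ℕ => dnWeight k n := by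
    refine Summable.of_nonneg_of_le (fun n => (dnWeight_pos hk0 hk1 n).le) (fun n => ?_)
      ((summable_geometric_of_lt_one hq0.le (ellipticNome_lt_one hk0 hk1)).mul_left
        (Real.pi / ellipticK k))
    -- The comparison is `1/(q^n + q^{-n}) ≤ q^n`; negative indices follow from evenness of the
    -- weight.
    refine mul_le_mul_of_nonneg_left ?_ (div_nonneg Real.pi_pos.le hK.le)
    rw [zpow_natCast, zpow_neg, zpow_natCast]
    have hp : 0 < ellipticNome k ^ n := by positivity
    rw [div_le_iff₀ (by positivity), mul_add, mul_inv_cancel₀ hp.ne']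
    nlinarith
  exact Summable.of_nat_of_neg hnat (by simpa only [dnWeight_neg] using hnat)

theorem sin_fourier_mul_ellipticK {k : ℝ} (hk0 : 0 < k) (hk1 : k < 1) (s : ℤ) :
    Real.sin (Real.pi * s / ellipticK k * ellipticK k) = 0 := by
  rw [div_mul_cancel₀ _ (ellipticK_pos hk0 hk1).ne', mul_comm, Real.sin_int_mul_pi]

theorem integral_jacobiDn_mul_sin {k : ℝ} (hk0 : 0 < k) (hk1 : k < 1) (l : ℝ) :
    ∫ x in -ellipticK k..ellipticK k, jacobiDn k x * Real.sin (l * x) = 0 := by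
  have h := intervalIntegral.integral_comp_neg (a := -ellipticK k) (b := ellipticK k)
    (fun x => jacobiDn k x * Real.sin (l * x))
  simp only [jacobiDn_neg hk0 hk1, mul_neg, Real.sin_neg, neg_neg,
    intervalIntegral.integral_neg] at h
  linarith

theorem integral_jacobiDn_mul_exp {k : ℝ} (hk0 : 0 < k) (hk1 : k < 1) (s : ℤ) :
    ∫ x in -ellipticK k..ellipticK k, Complex.exp (-(Complex.I * Real.pi * s / ellipticK k * x)) *
      (jacobiDn k x : ℂ) = ((2 * ellipticK k * dnWeight k s : ℝ) : ℂ) := by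
  set l := Real.pi * s / ellipticK k with hl
  have hd := continuous_jacobiDn hk0 hk1
  have h1 : ∀ x : ℝ, Complex.exp (-(Complex.I * Real.pi * s / ellipticK k * x)) *
      (jacobiDn k x : ℂ) = ((jacobiDn k x * Real.cos (l * x) : ℝ) : ℂ) -
        Complex.I * ((jacobiDn k x * Real.sin (l * x) : ℝ) : ℂ) := fun x => by
    rw [show -(Complex.I * Real.pi * s / ellipticK k * x) = ((-(l * x) : ℝ) : ℂ) * Complex.I by
      rw [hl]; push_cast; ring, Complex.exp_mul_I, ← Complex.ofReal_cos, ← Complex.ofReal_sin,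
      Real.cos_neg, Real.sin_neg]
    push_cast
    ring
  simp only [h1]
  rw [intervalIntegral.integral_sub (Continuous.intervalIntegrable (by fun_prop) _ _)
    (Continuous.intervalIntegrable (by fun_prop) _ _), intervalIntegral.integral_const_mul,
    intervalIntegral.integral_ofReal, intervalIntegral.integral_ofReal,
    integral_jacobiDn_mul_sin hk0 hk1, Complex.ofReal_zero, mul_zero, sub_zero]
  have h2 := integral_jacobiDn_mul_cos hk0 hk1 (sin_fourier_mul_ellipticK hk0 hk1 s)
  rw [← hl] at h2
  rw [dnWeight, ellipticNome_zpow_add, ← hl, ← h2]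
  have := (Real.cosh_pos (l * ellipticK (complModulus k))).ne'
  have := (ellipticK_pos hk0 hk1).ne'
  congr 1
  field_simp

/-- The Fourier series of `dn`. -/
theorem hasSum_dnWeight_mul_exp {k : ℝ} (hk0 : 0 < k) (hk1 : k < 1) (u : ℝ) :
    HasSum (fun s : ℤ => (dnWeight k s : ℂ) *
      Complex.exp (Complex.I * Real.pi * s / ellipticK k * u)) (jacobiDn k u : ℂ) := by
  have hK := ellipticK_pos hk0 hk1
  have : Fact (0 < 2 * ellipticK k) := ⟨by linarith⟩
  have hd := continuous_jacobiDn hk0 hk1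
  have hper : Function.Periodic (fun x => (jacobiDn k x : ℂ)) (2 * ellipticK k) := fun x => by
    simp only [jacobiDn_add_two_mul_ellipticK hk0 hk1]
  let f : C(AddCircle (2 * ellipticK k), ℂ) :=
    ⟨hper.lift, continuous_coinduced_dom.2 (by
      change Continuous fun x => (jacobiDn k x : ℂ)
      fun_prop)⟩
  have hfx : ∀ x : ℝ, f (x : AddCircle (2 * ellipticK k)) = jacobiDn k x := fun x => rfl
  have hfour : ∀ (s : ℤ) (x : ℝ), fourier s (x : AddCircle (2 * ellipticK k)) =
      Complex.exp (Complex.I * Real.pi * s / ellipticK k * x) := fun s x => by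
    rw [fourier_coe_apply]
    congr 1
    have : (ellipticK k : ℂ) ≠ 0 := by exact_mod_cast hK.ne'
    push_cast
    field_simp
  have hcoeff : fourierCoeff f = fun s => (dnWeight k s : ℂ) := by
    funext s
    -- The base point `-K` makes the period interval symmetric, so that evenness of `dn` applies.
    rw [fourierCoeff_eq_intervalIntegral _ _ (-ellipticK k),
      show -ellipticK k + 2 * ellipticK k = ellipticK k by ring]
    simp only [hfour, hfx, smul_eq_mul]
    have h := integral_jacobiDn_mul_exp hk0 hk1 s
    have he : ∀ x : ℝ, Complex.exp (Complex.I * Real.pi * ((-s : ℤ) : ℂ) / ellipticK k * x) =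
        Complex.exp (-(Complex.I * Real.pi * s / ellipticK k * x)) := fun x => by
      congr 1
      push_cast
      ring
    simp only [he, h]
    rw [Complex.real_smul, ← Complex.ofReal_mul]
    congr 1
    field_simp
  have hsum : Summable (fourierCoeff f) := by
    rw [hcoeff]
    exact_mod_cast summable_dnWeight hk0 hk1
  have h := has_pointwise_sum_fourier_series_of_summable hsum u
  simpa only [hcoeff, hfour, hfx, smul_eq_mul] using h

/-! ### The discrete measure on the unit circle. -/

theorem dnPoint_zpow (k w : ℝ) (s n : ℤ) : dnPoint k w s ^ n =
    Complex.exp (Complex.I * Real.pi * s / ellipticK k * (w * n : ℝ)) := by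
  rw [dnPoint, ← Complex.exp_int_mul]
  congr 1
  push_cast
  ring

theorem dnPoint_ne_zero (k w : ℝ) (s : ℤ) : dnPoint k w s ≠ 0 := Complex.exp_ne_zero _

theorem hasSum_dnWeight_mul_dnPoint_zpow {k : ℝ} (hk0 : 0 < k) (hk1 : k < 1) (w : ℝ) (n : ℤ) :
    HasSum (fun s : ℤ => (dnWeight k s : ℂ) * dnPoint k w s ^ n) (dnMoment k w n : ℂ) := by
  simpa only [dnPoint_zpow, dnMoment] using hasSum_dnWeight_mul_exp hk0 hk1 (w * n)

theorem dnPoint_injective {k w : ℝ} (hk0 : 0 < k) (hk1 : k < 1)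
    (hw : ∀ M N : ℤ, N ≠ 0 → w ≠ 2 * ellipticK k * M / N) : Function.Injective (dnPoint k w) := by
  intro s t h
  by_contra hst
  obtain ⟨M, hM⟩ := Complex.exp_eq_exp_iff_exists_int.1 h
  have hK : (ellipticK k : ℂ) ≠ 0 := by exact_mod_cast (ellipticK_pos hk0 hk1).ne'
  have hpi : (Real.pi : ℂ) ≠ 0 := by exact_mod_cast Real.pi_ne_zero
  have hst' : s - t ≠ 0 := sub_ne_zero.2 hst
  apply hw M (s - t) hst'
  rw [eq_div_iff (by exact_mod_cast hst')]
  field_simp at hM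
  have h2 : ((w * ((s - t : ℤ) : ℝ) : ℝ) : ℂ) = ((2 * ellipticK k * M : ℝ) : ℂ) := by
    push_cast
    linear_combination hM
  exact_mod_cast h2

/-- The condition on `w` says that `w/(2K)` is irrational, so the multiples of `w` are dense modulo
`2K`. The identification of that quotient with the circle carries this over, and the circle is
closed in `ℂ`. -/
theorem closure_range_dnPoint {k w : ℝ} (hk0 : 0 < k) (hk1 : k < 1)
    (hw : ∀ M N : ℤ, N ≠ 0 → w ≠ 2 * ellipticK k * M / N) :
    closure (Set.range (dnPoint k w)) = Metric.sphere (0 : ℂ) 1 := by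
  have hK := ellipticK_pos hk0 hk1
  have hirr : Irrational (w / (2 * ellipticK k)) := by
    rintro ⟨r, hr⟩
    refine hw r.num r.den (by exact_mod_cast r.den_ne_zero) ?_
    rw [eq_div_iff (by positivity)] at hr
    rw [← hr]
    conv_lhs => rw [← Rat.num_div_den r]
    push_cast
    ring
  have hdense := AddCircle.denseRange_zsmul_coe_iff.2 hirr
  have hz : ∀ s : ℤ, dnPoint k w s =
      ((AddCircle.toCircle (s • (w : AddCircle (2 * ellipticK k))) : Circle) : ℂ) := fun s => by
    rw [← AddCircle.coe_zsmul, AddCircle.toCircle_apply_mk, Circle.coe_exp, dnPoint]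
    congr 1
    have : (ellipticK k : ℂ) ≠ 0 := by exact_mod_cast hK.ne'
    push_cast
    rw [zsmul_eq_mul]
    field_simp
  have hsurj : Function.Surjective (AddCircle.toCircle (T := 2 * ellipticK k)) := fun z => by
    obtain ⟨x, hx⟩ :=
      (AddCircle.homeomorphCircle (by positivity : 2 * ellipticK k ≠ 0)).surjective z
    exact ⟨x, by rw [← hx, AddCircle.homeomorphCircle_apply]⟩
  have hd2 := hsurj.denseRange.comp hdense AddCircle.continuous_toCircle
  have hr : Set.range (dnPoint k w) = ((↑) : Circle → ℂ) '' Set.range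
      (AddCircle.toCircle ∘ (· • (w : AddCircle (2 * ellipticK k)) : ℤ → _)) := by
    rw [← Set.range_comp]
    congr 1
    funext s
    exact hz s
  have hcl : Topology.IsClosedEmbedding ((↑) : Circle → ℂ) :=
    (Metric.isClosed_sphere (x := (0 : ℂ)) (ε := 1)).isClosedEmbedding_subtypeVal
  rw [hr]
  refine (hcl.closure_image_eq _).trans ((congrArg _ hd2.closure_range).trans ?_)
  exact Set.image_univ.trans Subtype.range_coe

theorem hasSum_dnWeight_mul_aeval {k : ℝ} (hk0 : 0 < k) (hk1 : k < 1) (w : ℝ) (p q : ℝ[X]) :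
    HasSum (fun s : ℤ => (dnWeight k s : ℂ) * aeval (dnPoint k w s) p *
      aeval (1 / dnPoint k w s) q) ((momentFunctional (dnMoment k w)
        (toLaurent p * LaurentPolynomial.invert (toLaurent q)) : ℝ) : ℂ) := by
  rw [toLaurent_mul_invert_toLaurent le_rfl le_rfl]
  simp only [map_sum, map_smul, momentFunctional_T, smul_eq_mul, Complex.ofReal_sum]
  have h := hasSum_sum (s := Finset.range (q.natDegree + 1)) fun i _ =>
    hasSum_sum (s := Finset.range (p.natDegree + 1)) fun j _ =>
      (hasSum_dnWeight_mul_dnPoint_zpow hk0 hk1 w ((j : ℤ) - i)).mul_left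
        ((q.coeff i * p.coeff j : ℝ) : ℂ)
  convert! h using 1
  · funext s
    rw [aeval_eq_sum_range, aeval_eq_sum_range, mul_assoc, Finset.sum_mul_sum, Finset.sum_comm,
      Finset.mul_sum]
    refine Finset.sum_congr rfl fun i _ => ?_
    rw [Finset.mul_sum]
    refine Finset.sum_congr rfl fun j _ => ?_
    rw [zpow_sub₀ (dnPoint_ne_zero k w s), zpow_natCast, zpow_natCast, Complex.real_smul,
      Complex.real_smul, one_div, inv_pow]
    push_cast
    ring
  · refine Finset.sum_congr rfl fun i _ => Finset.sum_congr rfl fun j _ => ?_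
    push_cast
    ring

/-! ### Assembly. -/

/-- `HasSum` over `ℤ` with values in `ℂ` is unconditional, equivalently absolute, convergence. The
coefficient formulas hold for every `s`, since `ellipticBinom` is `0` when `s > n`. -/
theorem theorem2 (k w : ℝ) (hk0 : 0 < k) (hk1 : k < 1)
    (hw : ∀ M N : ℤ, N ≠ 0 → w ≠ 2 * ellipticK k * M / N) :
    -- nondegeneracy, monicity, and orthogonality with respect to the moment functional
    (∀ n : ℕ, 0 < toeplitzDet (dnMoment k w) n) ∧
    (∀ n : ℕ, (dnPoly k w n).Monic ∧ (dnPoly k w n).natDegree = n) ∧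
    (∀ n m : ℕ,
      momentFunctional (dnMoment k w)
          (toLaurent (dnPoly k w n) * LaurentPolynomial.invert (toLaurent (dnPoly k w m))) =
        if n = m then circleNorm (dnMoment k w) n else 0) ∧
    -- reflection parameters and the recurrence relation that they determine
    (∀ n : ℕ, reflectionParam (dnPoly k w) (2 * n) = jacobiDn k (w * (2 * n + 1))) ∧
    (∀ n : ℕ, reflectionParam (dnPoly k w) (2 * n + 1) = -jacobiCn k (w * (2 * n + 2))) ∧
    (∀ n : ℕ, -1 < reflectionParam (dnPoly k w) n ∧ reflectionParam (dnPoly k w) n < 1) ∧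
    dnPoly k w 0 = 1 ∧
    (∀ n : ℕ, dnPoly k w (n + 1) =
      X * dnPoly k w n - C (reflectionParam (dnPoly k w) n) * (dnPoly k w n).reflect n) ∧
    -- explicit coefficients
    (∀ n s : ℕ, Even n → (dnPoly k w n).coeff s =
      (-1) ^ s * jacobiCn k (w * ((n : ℝ) - s)) * ellipticBinom k w n s) ∧
    (∀ n s : ℕ, Odd n → (dnPoly k w n).coeff s =
      (-1) ^ (s + 1) * jacobiDn k (w * ((n : ℝ) - s)) * ellipticBinom k w n s) ∧
    -- the measure: positive weights at distinct points that are dense on the unit circle,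
    -- with moments `dn(w n)`
    (∀ s : ℤ, 0 < dnWeight k s) ∧
    Function.Injective (dnPoint k w) ∧
    closure (Set.range (dnPoint k w)) = Metric.sphere (0 : ℂ) 1 ∧
    (∀ n : ℤ, HasSum (fun s : ℤ => (dnWeight k s : ℂ) * dnPoint k w s ^ n)
      (dnMoment k w n : ℂ)) ∧
    -- the orthogonality relation and its normalization constants
    (∀ n : ℕ, 0 < circleNorm (dnMoment k w) n ∧ circleNorm (dnMoment k w) n =
      ∏ i ∈ Finset.range n, (1 - reflectionParam (dnPoly k w) i ^ 2)) ∧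
    (∀ n m : ℕ, HasSum
      (fun s : ℤ => (dnWeight k s : ℂ) * aeval (dnPoint k w s) (dnPoly k w n) *
        aeval (1 / dnPoint k w s) (dnPoly k w m))
      (if n = m then (circleNorm (dnMoment k w) n : ℂ) else 0)) := by
  have hd := szegoPoly_natDegree_le_and_coeff (dnReflection k w)
  have hpoly := dnPoly_eq_szegoPoly hk0 hk1 hw
  have hrefl := reflectionParam_dnPoly hk0 hk1 hw
  refine ⟨toeplitzDet_dnMoment_pos hk0 hk1 hw, fun n => ?_, momentFunctional_dnPoly hk0 hk1 hw,
    fun n => ?_, fun n => ?_, fun n => ?_, ?_, fun n => ?_, fun n s hn => ?_, fun n s hn => ?_,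
    dnWeight_pos hk0 hk1, dnPoint_injective hk0 hk1 hw, closure_range_dnPoint hk0 hk1 hw,
    hasSum_dnWeight_mul_dnPoint_zpow hk0 hk1 w, fun n => ⟨?_, ?_⟩, fun n m => ?_⟩
  · rw [hpoly]
    have hdeg : (szegoPoly (dnReflection k w) n).natDegree = n :=
      le_antisymm (hd n).1 (le_natDegree_of_ne_zero (by rw [(hd n).2]; exact one_ne_zero))
    exact ⟨by rw [Monic, leadingCoeff, hdeg, (hd n).2], hdeg⟩
  · rw [hrefl, dnReflection, if_pos (even_two_mul n)]
    push_cast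
    rfl
  · rw [hrefl, dnReflection, if_neg (by simp)]
    push_cast
    rw [show w * (2 * (n : ℝ) + 1 + 1) = w * (2 * n + 2) by ring]
  · rw [hrefl]
    exact abs_lt.1 (abs_dnReflection_lt_one hk0 hk1 hw n)
  · rw [hpoly, szegoPoly]
  · rw [hpoly, hpoly, hrefl, szegoPoly]
  · rw [dnPoly_coeff hk0 hk1 hw, if_pos hn]
  · rw [dnPoly_coeff hk0 hk1 hw, if_neg (Nat.not_even_iff_odd.2 hn)]
  · rw [circleNorm_dnMoment hk0 hk1 hw]
    exact shiftedMoment_szegoPoly_self_pos hk0 hk1 hw n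
  · simp only [circleNorm_dnMoment hk0 hk1 hw, shiftedMoment_szegoPoly_self hk0 hk1, hrefl]
  · have h := hasSum_dnWeight_mul_aeval hk0 hk1 w (dnPoly k w n) (dnPoly k w m)
    rw [momentFunctional_dnPoly hk0 hk1 hw] at h
    split_ifs at h ⊢ with hnm
    · exact h
    · simpa using h
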